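/- Let $\mathbb K=\mathbb R$ or $\mathbb C$, let $m\ge 2$, and write $\ell_p^n$ for $\mathbb K^n$ with the $\ell_p$ norm. For $p=(p_1,\dots,p_m)\in[1,\infty]^m$ and an $m$-linear form $A\colon \ell_{p_1}^n\times\cdots\times\ell_{p_m}^n\to\mathbb K$ put $$\|A\|=\sup\{|A(z^{(1)},\dots,z^{(m)})| : \|z^{(k)}\|_{\ell_{p_k}^n}\le 1,\ 1\le k\le m\}.$$ For $t=(t_1,\dots,t_m)\in(0,\infty]^m$ we say that the Hardy--Littlewood (HL) inequality for $p$ with exponents $t$ holds with constant $C$ if, for all positive integers $n$ and all $m$-linear forms $A\colon \ell_{p_1}^n\times\cdots\times\ell_{p_m}^n\to\mathbb K$, $$\left(\sum_{j_1=1}^n\left(\cdots\left(\sum_{j_m=1}^n|A(e_{j_1},\dots,e_{j_m})|^{t_m}\right)^{\frac{t_{m-1}}{t_m}}\cdots\right)^{\frac{t_1}{t_2}}\right)^{\frac1{t_1}}\le C\,\|A\|,$$ where $(\sum_j|a_j|^{t})^{1/t}$ means $\sup_j|a_j|$ if $t=\infty$. We call $t$ admissible (for $p$ and $\mathbb K$)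 if this holds with some constant $C<\infty$. **Proposition.** For every $m\ge2$ there is a constant $C_m$, depending only on $m$, with the following property. Let $p_1,\dots,p_m\in[1,\infty]$ satisfy $$\frac1{p_1}+\cdots+\frac1{p_m}=1,\qquad \frac12\le\frac1{p_2}+\cdots+\frac1{p_m}<1$$ (with $1/\infty=0$). Let $k_0=\max\{t : 1/p_t+\cdots+1/p_m\ge 1/2\}$ and $$s_k=\begin{cases}\left[1-\left(\frac1{p_k}+\cdots+\frac1{p_m}\right)\right]^{-1}, & 1\le k\le k_0,\\ 2, & k>k_0,\end{cases}$$ with $1/0=\infty$, so that $s_1=\infty$. Then the HL inequality for $p$ with exponents $(s_1,\dots,s_m)$ holds with constant $C_m$. Moreover: (i) The exponents $s_1,\dots,s_{k_0}$ are optimal: for each $k\le k_0$, $s_k$ is the smallest value of $t_k$ among all admissible tuples $(t_1,\dots,t_m)\in(0,\infty]^m$. (ii) If $p_{k_0}\ge2$, then $(s_1,\dots,s_m)$ is globally sharp: it is admissible, and for every $k$ and every $r$ with $0<r<s_k$ the tuple $(s_1,\dots,s_{k-1},r,s_{k+1},\dots,s_m)$ is not admissible. -/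

import Mathlib

open scoped ENNReal

noncomputable section

namespace HardyLittlewood

/-- The `ℓ_p` norm of a finite sequence; for `p = ∞` this is `max_j ‖x j‖`. -/
def lpNorm {E : Type*} [NormedAddCommGroup E] {n : ℕ} (p : ℝ≥0∞) (x : Fin n → E) : ℝ :=
  ‖(WithLp.toLp p x : PiLp p (fun _ : Fin n => E))‖

/-- The anisotropic (iterated) norm of an array `(a (j₁, …, j_m))` with exponents
`s₁, …, s_m`, the first index being the outermost one:
`(∑_{j₁} (⋯ (∑_{j_m} |a (j₁, …, j_m)| ^ s_m) ^ (s_{m-1} / s_m) ⋯) ^ (s₁ / s₂)) ^ (1 / s₁)`,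
where `(∑_j |b j| ^ s) ^ (1 / s)` means `sup_j |b j|` when `s = ∞`. -/
def mixedNorm {E : Type*} [Norm E] {n : ℕ} :
    {m : ℕ} → (Fin m → ℝ≥0∞) → ((Fin m → Fin n) → E) → ℝ
  | 0, _, a => ‖a Fin.elim0‖
  | _ + 1, s, a =>
      lpNorm (s 0) (fun j : Fin n =>
        mixedNorm (fun k => s k.succ) (fun i => a (Fin.cons j i)))

/-- The norm of an `m`-linear form `A : ℓ_{p₁}ⁿ × ⋯ × ℓ_{p_m}ⁿ → 𝕜`, that is
`sup {|A (z₁, …, z_m)| : ‖z_k‖_{ℓ_{p_k}ⁿ} ≤ 1 for all k}`. -/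
def formNorm {𝕜 : Type*} [RCLike 𝕜] {m n : ℕ} (p : Fin m → ℝ≥0∞)
    (A : MultilinearMap 𝕜 (fun _ : Fin m => Fin n → 𝕜) 𝕜) : ℝ :=
  sSup {x : ℝ | ∃ z : Fin m → Fin n → 𝕜,
    (∀ k, lpNorm (p k) (z k) ≤ 1) ∧ x = ‖A z‖}

/-- The Hardy-Littlewood inequality for `m`-linear forms on `ℓ_{p₁}ⁿ × ⋯ × ℓ_{p_m}ⁿ` with
exponents `t₁, …, t_m` holds with the constant `C`, for every `n`. -/
def HLInequalityWith (𝕜 : Type*) [RCLike 𝕜] {m : ℕ} (p t : Fin m → ℝ≥0∞) (C : ℝ) : Prop :=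
  ∀ n : ℕ, 0 < n → ∀ A : MultilinearMap 𝕜 (fun _ : Fin m => Fin n → 𝕜) 𝕜,
    mixedNorm t (fun j : Fin m → Fin n => A (fun k => Pi.single (j k) 1)) ≤ C * formNorm p A

/-- The exponents `t₁, …, t_m ∈ (0, ∞]` are admissible: the Hardy-Littlewood inequality holds
for them with some constant independent of `n` and of the form. -/
def Admissible (𝕜 : Type*) [RCLike 𝕜] {m : ℕ} (p t : Fin m → ℝ≥0∞) : Prop :=
  (∀ k, 0 < t k) ∧ ∃ C : ℝ, HLInequalityWith 𝕜 p t C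

/-- `r` is the optimal exponent in position `k`: it is the smallest exponent which occurs in
position `k` of an admissible tuple, whatever the other exponents of the tuple are. -/
def IsOptimalExponent (𝕜 : Type*) [RCLike 𝕜] {m : ℕ} (p : Fin m → ℝ≥0∞) (k : Fin m)
    (r : ℝ≥0∞) : Prop :=
  IsLeast {x : ℝ≥0∞ | ∃ t : Fin m → ℝ≥0∞, Admissible 𝕜 p t ∧ t k = x} r

/-- The tuple `t` is globally sharp: it is admissible, and it is no longer admissible when any
single one of its entries is replaced by a strictly smaller positive exponent. -/
def GloballySharp (𝕜 : Type*) [RCLike 𝕜] {m : ℕ} (p t : Fin m → ℝ≥0∞) : Prop :=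
  Admissible 𝕜 p t ∧
    ∀ (k : Fin m) (r : ℝ≥0∞), 0 < r → r < t k → ¬ Admissible 𝕜 p (Function.update t k r)

/-- `1 / p_k + ⋯ + 1 / p_m` (with `1 / ∞ = 0`). -/
def tailSum {m : ℕ} (p : Fin m → ℝ≥0∞) (k : Fin m) : ℝ≥0∞ :=
  ∑ i ∈ Finset.Ici k, 1 / p i

/-- The exponents `s_k = [1 - (1 / p_k + ⋯ + 1 / p_m)]⁻¹` for `k ≤ k₀` and `s_k = 2` for
`k > k₀` (with `1 / 0 = ∞`). -/
def exponents {m : ℕ} (p : Fin m → ℝ≥0∞) (k₀ : Fin m) (k : Fin m) : ℝ≥0∞ :=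
  if k ≤ k₀ then (1 - tailSum p k)⁻¹ else 2

end HardyLittlewood

end

noncomputable section

namespace HardyLittlewood

open MeasureTheory Finset

/-! ### Finite `ℓ_p` norms on the whole range of exponents: Hölder, Minkowski and duality. -/

section LpNorm

variable {E F : Type*} [NormedAddCommGroup E] [NormedAddCommGroup F] {n : ℕ}

/-! Upper bound. If the reciprocals 1/p_k add up to exactly 1/2, the coefficients are bounded in ℓ₂
(`sqrt_sum_le_of_sum_inv_eq_half`): normalise |a_J|² to a probability, test the form on the powers
μ_k^{1/p_k} of its marginals, and combine the (ℓ₁, ℓ₂) Khinchine inequalities for the different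
slots by Cauchy-Schwarz and a weighted AM-GM. If the sum exceeds 1/2 only because of the first slot,
the excess of 1/p_1 is split off as a multiplier, and Hölder duality converts it into the outer
exponent (`mixedNorm_le_of_inner_two`).

The other slots are added on the left, one at a time (`mixedNorm_exponents_le`). Contracting the
first variable with w leaves a form of smaller order. Random signs on w and Khinchine produce a
square function in the new index; Minkowski moves this index outside, because the inner exponents
are at least 2 and the first of them is the largest. Duality in w then gives 1/s_k = 1/s_{k+1} -
1/p_k. Each added slot costs a factor √3.

Sharpness. The form ∏_{l<k} z_l(i) · ∑_j ∏_{l≥k} z_l(j) has norm at most n^{1-(1/p_k+⋯+1/p_m)} and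
mixed norm n^{1/t_k}, which bounds t_k from below in every admissible tuple (`Admissible.inv_le`).
For positions after k₀, forms with random signs in the slots l ≥ k₀ bound ∑_{l≥k₀} 1/t_l from above
(`Admissible.sum_le`). The exponents s_l attain equality there, so none of them can be lowered
alone. -/

lemma lpNorm_eq_sum {p : ℝ≥0∞} (h0 : p ≠ 0) (ht : p ≠ ∞) (x : Fin n → E) :
    lpNorm p x = (∑ j, ‖x j‖ ^ p.toReal) ^ (1 / p.toReal) :=
  PiLp.norm_eq_sum (ENNReal.toReal_pos h0 ht) _

lemma lpNorm_top (x : Fin n → E) : lpNorm ∞ x = ⨆ j, ‖x j‖ :=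
  PiLp.norm_eq_ciSup _

lemma lpNorm_two (x : Fin n → E) : lpNorm 2 x = √(∑ j, ‖x j‖ ^ 2) :=
  PiLp.norm_eq_of_L2 _

lemma lpNorm_one_eq (x : Fin n → E) : lpNorm 1 x = ∑ j, ‖x j‖ :=
  PiLp.norm_eq_of_L1 _

lemma lpNorm_congr {p : ℝ≥0∞} (hp : p ≠ 0) {x : Fin n → E} {y : Fin n → F}
    (h : ∀ j, ‖x j‖ = ‖y j‖) : lpNorm p x = lpNorm p y := by
  rcases eq_or_ne p ∞ with rfl | ht
  · simp [lpNorm_top, h]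
  · simp [lpNorm_eq_sum hp ht, h]

lemma lpNorm_nonneg {p : ℝ≥0∞} (hp : p ≠ 0) (x : Fin n → E) : 0 ≤ lpNorm p x := by
  rcases eq_or_ne p ∞ with rfl | ht
  · rw [lpNorm_top]; exact Real.iSup_nonneg fun _ => norm_nonneg _
  · rw [lpNorm_eq_sum hp ht]; positivity

lemma lpNorm_mono {p : ℝ≥0∞} (hp : p ≠ 0) {x : Fin n → E} {y : Fin n → F}
    (h : ∀ j, ‖x j‖ ≤ ‖y j‖) : lpNorm p x ≤ lpNorm p y := by
  rcases eq_or_ne p ∞ with rfl | ht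
  · simp only [lpNorm_top]; exact ciSup_mono (Set.finite_range _).bddAbove h
  · rw [lpNorm_eq_sum hp ht, lpNorm_eq_sum hp ht]; gcongr; exact h _

lemma norm_apply_le_lpNorm {p : ℝ≥0∞} (hp : p ≠ 0) (x : Fin n → E) (j : Fin n) :
    ‖x j‖ ≤ lpNorm p x := by
  rcases eq_or_ne p ∞ with rfl | ht
  · rw [lpNorm_top]; exact le_ciSup (f := fun j => ‖x j‖) (Set.finite_range _).bddAbove j
  · have hp' := ENNReal.toReal_pos hp ht
    rw [lpNorm_eq_sum hp ht]
    calc ‖x j‖ = (‖x j‖ ^ p.toReal) ^ (1 / p.toReal) := by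
          rw [← Real.rpow_mul (norm_nonneg _), mul_one_div_cancel hp'.ne', Real.rpow_one]
      _ ≤ _ := by
          gcongr
          exact single_le_sum (f := fun j => ‖x j‖ ^ p.toReal) (fun _ _ => by positivity)
            (mem_univ j)

lemma lpNorm_mul_left {p : ℝ≥0∞} (hp : p ≠ 0) {c : ℝ} (hc : 0 ≤ c) {x : Fin n → E}
    {y : Fin n → F} (h : ∀ j, ‖x j‖ = c * ‖y j‖) : lpNorm p x = c * lpNorm p y := by
  rcases eq_or_ne p ∞ with rfl | ht
  · simp only [lpNorm_top, h, Real.mul_iSup_of_nonneg hc]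
  · have hp' := ENNReal.toReal_pos hp ht
    simp only [lpNorm_eq_sum hp ht, h]
    simp_rw [Real.mul_rpow hc (norm_nonneg _)]
    rw [← mul_sum, Real.mul_rpow (by positivity) (by positivity), ← Real.rpow_mul hc,
      mul_one_div_cancel hp'.ne', Real.rpow_one]

lemma lpNorm_add_le {p : ℝ≥0∞} (hp : 1 ≤ p) (x y : Fin n → E) :
    lpNorm p (fun j => x j + y j) ≤ lpNorm p x + lpNorm p y := by
  have : Fact (1 ≤ p) := ⟨hp⟩
  exact norm_add_le (WithLp.toLp p x : PiLp p (fun _ : Fin n => E)) (WithLp.toLp p y)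

lemma lpNorm_zero {p : ℝ≥0∞} (hp : p ≠ 0) : lpNorm p (fun _ : Fin n => (0 : E)) = 0 := by
  simpa using lpNorm_mul_left (E := E) (F := E) hp le_rfl
    (x := fun _ : Fin n => (0 : E)) (y := fun _ => 0) (by simp)

lemma lpNorm_sum_le {p : ℝ≥0∞} (hp : 1 ≤ p) {ι : Type*} (s : Finset ι) (x : ι → Fin n → E) :
    lpNorm p (fun j => ∑ i ∈ s, x i j) ≤ ∑ i ∈ s, lpNorm p (x i) := by
  classical
  induction s using Finset.induction_on with
  | empty => simp [lpNorm_zero (zero_lt_one.trans_le hp).ne']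
  | insert i s hi ih =>
    simp only [sum_insert hi]
    exact (lpNorm_add_le hp _ _).trans (by gcongr)

lemma lpNorm_single {p : ℝ≥0∞} (hp : p ≠ 0) (i : Fin n) (c : E) :
    lpNorm p (Pi.single i c) = ‖c‖ := by
  apply le_antisymm
  · rcases eq_or_ne p ∞ with rfl | ht
    · rw [lpNorm_top]
      refine Real.iSup_le (fun j => ?_) (norm_nonneg _)
      by_cases h : j = i
      · subst h; simp
      · simp [h]
    · have hp' := ENNReal.toReal_pos hp ht
      rw [lpNorm_eq_sum hp ht, sum_eq_single i (fun j _ h => by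
        simp [h, Real.zero_rpow hp'.ne']) (by simp)]
      rw [← Real.rpow_mul (norm_nonneg _), mul_one_div_cancel hp'.ne', Real.rpow_one]
      simp
  · simpa using norm_apply_le_lpNorm hp (Pi.single i c) i

lemma lpNorm_of_norm_eq_one {p : ℝ≥0∞} (hp : p ≠ 0) (hn : 0 < n) {x : Fin n → E}
    (hx : ∀ j, ‖x j‖ = 1) : lpNorm p x = (n : ℝ) ^ (p⁻¹).toReal := by
  have : Nonempty (Fin n) := ⟨⟨0, hn⟩⟩
  rcases eq_or_ne p ∞ with rfl | ht
  · simp [lpNorm_top, hx]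
  · simp [lpNorm_eq_sum hp ht, hx, ENNReal.toReal_inv]

/-- Passing to counting measure makes Hölder's inequality available for all exponents, including
those below 1. -/
lemma lpNorm_eq_eLpNorm {p : ℝ≥0∞} (hp : p ≠ 0) (x : Fin n → E) :
    lpNorm p x = (eLpNorm x p Measure.count).toReal := by
  rcases eq_or_ne p ∞ with rfl | ht
  · rw [lpNorm_top, eLpNorm_exponent_top, eLpNormEssSup, essSup_count,
      ENNReal.toReal_iSup (by finiteness)]
    simp
  · rw [lpNorm_eq_sum hp ht, eLpNorm_eq_lintegral_rpow_enorm_toReal hp ht, lintegral_count,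
      tsum_fintype, ← ENNReal.toReal_rpow, ENNReal.toReal_sum (by finiteness)]
    simp [← ENNReal.toReal_rpow]

/-- Hölder's inequality for finite sequences, for all exponents in `[0, ∞]`. -/
lemma lpNorm_mul_le {p q r : ℝ≥0∞} (hp : p ≠ 0) (hq : q ≠ 0) (hr : r ≠ 0)
    (h : r⁻¹ = p⁻¹ + q⁻¹) {R : Type*} [NormedCommRing R] [NormMulClass R] (x y : Fin n → R) :
    lpNorm r (fun j => x j * y j) ≤ lpNorm p x * lpNorm q y := by
  have : ENNReal.HolderTriple p q r := ⟨h.symm⟩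
  have hfin : ∀ (s : ℝ≥0∞) (z : Fin n → R), eLpNorm z s Measure.count < ∞ := fun s z =>
    eLpNorm_count_lt_top_of_lt fun i => by simp
  rw [lpNorm_eq_eLpNorm hp, lpNorm_eq_eLpNorm hq, lpNorm_eq_eLpNorm hr, ← ENNReal.toReal_mul]
  refine ENNReal.toReal_mono (ENNReal.mul_ne_top (hfin _ _).ne (hfin _ _).ne) ?_
  exact eLpNorm_smul_le_mul_eLpNorm (f := y) (φ := x)
    StronglyMeasurable.of_discrete.aestronglyMeasurable
    StronglyMeasurable.of_discrete.aestronglyMeasurable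

lemma lpNorm_anti {p q : ℝ≥0∞} (hp : p ≠ 0) (hpq : p ≤ q) (x : Fin n → E) :
    lpNorm q x ≤ lpNorm p x := by
  have hq : q ≠ 0 := (pos_iff_ne_zero.2 hp |>.trans_le hpq).ne'
  rcases eq_or_ne q ∞ with rfl | hqt
  · rw [lpNorm_top]
    exact Real.iSup_le (norm_apply_le_lpNorm hp x) (lpNorm_nonneg hp x)
  have hpt : p ≠ ∞ := ne_top_of_le_ne_top hqt hpq
  have hp' := ENNReal.toReal_pos hp hpt
  have hq' := ENNReal.toReal_pos hq hqt
  have hpq' : p.toReal ≤ q.toReal := ENNReal.toReal_mono hqt hpq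
  rcases (lpNorm_nonneg hp x).eq_or_lt with h0 | h0
  · have : ∀ j, ‖x j‖ = ‖(0 : E)‖ := fun j => by
      simpa [← h0] using norm_apply_le_lpNorm hp x j
    rw [lpNorm_congr hq (y := fun _ => (0 : E)) this, lpNorm_zero hq]
    exact h0.le
  set c := lpNorm p x with hc
  have hcp : ∑ j, ‖x j‖ ^ p.toReal = c ^ p.toReal := by
    rw [hc, lpNorm_eq_sum hp hpt, ← Real.rpow_mul (by positivity), one_div_mul_cancel hp'.ne',
      Real.rpow_one]
  -- Every entry is at most c, so the surplus power q - p can be estimated by c.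
  have key : ∑ j, ‖x j‖ ^ q.toReal ≤ c ^ q.toReal := by
    calc ∑ j, ‖x j‖ ^ q.toReal ≤ ∑ j, ‖x j‖ ^ p.toReal * c ^ (q.toReal - p.toReal) := by
          gcongr with j
          rcases (norm_nonneg (x j)).eq_or_lt with hj | hj
          · rw [← hj, Real.zero_rpow hq'.ne']; positivity
          · calc ‖x j‖ ^ q.toReal = ‖x j‖ ^ p.toReal * ‖x j‖ ^ (q.toReal - p.toReal) := by
                  rw [← Real.rpow_add hj]; congr 1; ring
              _ ≤ _ := by
                  gcongr
                  · exact norm_apply_le_lpNorm hp x j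
      _ = c ^ q.toReal := by
          rw [← sum_mul, hcp, ← Real.rpow_add h0]; congr 1; ring
  rw [lpNorm_eq_sum hq hqt]
  calc _ ≤ (c ^ q.toReal) ^ (1 / q.toReal) := by gcongr
    _ = c := by rw [← Real.rpow_mul h0.le, mul_one_div_cancel hq'.ne', Real.rpow_one]

/-- Minkowski's inequality `ℓ_q(ℓ_s) ≤ ℓ_s(ℓ_q)` for `s ≤ q`. -/
lemma lpNorm_lpNorm_le {s q : ℝ≥0∞} (hs : s ≠ 0) (hsq : s ≤ q) {N : ℕ} (x : Fin N → Fin n → E) :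
    lpNorm q (fun j => lpNorm s (x j)) ≤ lpNorm s (fun i => lpNorm q (fun j => x j i)) := by
  have hq : q ≠ 0 := (pos_iff_ne_zero.2 hs |>.trans_le hsq).ne'
  rcases eq_or_ne q ∞ with rfl | hqt
  · rw [lpNorm_top (fun j => lpNorm s (x j))]
    refine Real.iSup_le (fun j => ?_) (lpNorm_nonneg hs _)
    rw [Real.norm_of_nonneg (lpNorm_nonneg hs _)]
    exact lpNorm_mono hs fun i =>
      (norm_apply_le_lpNorm (by simp) (fun j => x j i) j).trans (le_abs_self _)
  have hst : s ≠ ∞ := ne_top_of_le_ne_top hqt hsq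
  have hs' := ENNReal.toReal_pos hs hst
  have hq' := ENNReal.toReal_pos hq hqt
  have hr0 : q / s ≠ 0 := ENNReal.div_ne_zero.2 ⟨hq, hst⟩
  have hrt : q / s ≠ ∞ := ENNReal.div_ne_top hqt hs
  have hr1 : 1 ≤ q / s := by
    rw [ENNReal.le_div_iff_mul_le (.inl hs) (.inl hst), one_mul]; exact hsq
  have hr : (q / s).toReal = q.toReal / s.toReal := ENNReal.toReal_div _ _
  -- Minkowski is the triangle inequality of ℓ_{q/s} applied to the s-th powers; s itself may be
  -- below 1.
  have tri := lpNorm_sum_le hr1 univ (fun i (j : Fin N) => ‖x j i‖ ^ s.toReal)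
  have e1 : lpNorm (q / s) (fun j => ∑ i, ‖x j i‖ ^ s.toReal) =
      lpNorm q (fun j => lpNorm s (x j)) ^ s.toReal := by
    rw [lpNorm_eq_sum hr0 hrt, lpNorm_eq_sum hq hqt, hr, ← Real.rpow_mul (by positivity)]
    congr 1
    · refine sum_congr rfl fun j _ => ?_
      rw [Real.norm_of_nonneg (by positivity), Real.norm_of_nonneg (lpNorm_nonneg hs _),
        lpNorm_eq_sum hs hst, ← Real.rpow_mul (by positivity)]
      congr 1; field_simp
    · field_simp
  have e2 : ∀ i, lpNorm (q / s) (fun j => ‖x j i‖ ^ s.toReal) =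
      lpNorm q (fun j => x j i) ^ s.toReal := fun i => by
    rw [lpNorm_eq_sum hr0 hrt, lpNorm_eq_sum hq hqt, hr, ← Real.rpow_mul (by positivity)]
    congr 1
    · refine sum_congr rfl fun j _ => ?_
      rw [Real.norm_of_nonneg (by positivity), ← Real.rpow_mul (by positivity)]
      congr 1; field_simp
    · field_simp
  simp only [e1, e2] at tri
  rw [lpNorm_eq_sum hs hst (fun i => lpNorm q fun j => x j i)]
  simp only [Real.norm_of_nonneg (lpNorm_nonneg hq _)]
  calc lpNorm q (fun j => lpNorm s (x j)) =
      (lpNorm q (fun j => lpNorm s (x j)) ^ s.toReal) ^ (1 / s.toReal) := by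
        rw [← Real.rpow_mul (lpNorm_nonneg hq _), mul_one_div_cancel hs'.ne', Real.rpow_one]
    _ ≤ _ := Real.rpow_le_rpow (Real.rpow_nonneg (lpNorm_nonneg hq _) _) tri (by positivity)

/-- The `ℓ_s` norm is attained by multipliers from the unit ball of `ℓ_p` into `ℓ_q`. -/
lemma lpNorm_le_of_forall_mul {p q s : ℝ≥0∞} (hp : p ≠ 0) (hq : q ≠ 0) (hs : s ≠ 0)
    (h : q⁻¹ = s⁻¹ + p⁻¹) {b : Fin n → ℝ} (hb : ∀ j, 0 ≤ b j) {M : ℝ} (hM : 0 ≤ M)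
    (H : ∀ w : Fin n → ℝ, (∀ j, 0 ≤ w j) → lpNorm p w ≤ 1 → lpNorm q (fun j => w j * b j) ≤ M) :
    lpNorm s b ≤ M := by
  rcases eq_or_ne p ∞ with rfl | hpt
  · have hqs : q = s := by simpa using h
    subst hqs
    have := H 1 (by simp) (by
      rw [lpNorm_top]; exact Real.iSup_le (by simp) zero_le_one)
    simpa using this
  rcases eq_or_ne s ∞ with rfl | hst
  · have hqs : q = p := by simpa using h
    subst hqs
    rw [lpNorm_top]
    refine Real.iSup_le (fun j => ?_) hM
    have := H (Pi.single j 1) (fun i => by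
      by_cases hi : i = j
      · subst hi; simp
      · simp [hi]) (by simp [lpNorm_single hp])
    refine le_trans ?_ (this.trans' (norm_apply_le_lpNorm hp _ j))
    simp
  have hqt : q ≠ ∞ := by
    rintro rfl
    simp [eq_comm, hst, hpt] at h
  have hp' := ENNReal.toReal_pos hp hpt
  have hq' := ENNReal.toReal_pos hq hqt
  have hs' := ENNReal.toReal_pos hs hst
  have h' : (q.toReal)⁻¹ = (s.toReal)⁻¹ + (p.toReal)⁻¹ := by
    rw [← ENNReal.toReal_inv, h, ENNReal.toReal_add (by simpa) (by simpa), ENNReal.toReal_inv,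
      ENNReal.toReal_inv]
  set P := p.toReal
  set Q := q.toReal
  set S := s.toReal
  rcases (lpNorm_nonneg hs b).eq_or_lt with h0 | h0
  · rwa [← h0]
  set c := lpNorm s b with hc
  have hcS : ∑ j, b j ^ S = c ^ S := by
    rw [hc, lpNorm_eq_sum hs hst, ← Real.rpow_mul (by positivity), one_div_mul_cancel hs'.ne',
      Real.rpow_one]
    simp [abs_of_nonneg (hb _), S]
  have hbc : ∑ j, (b j / c) ^ S = 1 := by
    simp_rw [Real.div_rpow (hb _) h0.le]
    rw [← sum_div, hcS, div_self (by positivity)]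
  have hbc0 : ∀ j, 0 ≤ b j / c := fun j => div_nonneg (hb j) h0.le
  -- The equality case of Hölder serves as the multiplier.
  have hw := H (fun j => (b j / c) ^ (S / P)) (fun j => Real.rpow_nonneg (hbc0 j) _) (by
    rw [lpNorm_eq_sum hp hpt]
    simp_rw [Real.norm_of_nonneg (Real.rpow_nonneg (hbc0 _) _), ← Real.rpow_mul (hbc0 _)]
    rw [show S / P * p.toReal = S from div_mul_cancel₀ _ hp'.ne', hbc, Real.one_rpow])
  refine hw.trans' (le_of_eq ?_)
  have e : ∀ j, ‖(b j / c) ^ (S / P) * b j‖ = c * ‖(b j / c) ^ (S / Q)‖ := fun j => by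
    rw [Real.norm_of_nonneg (mul_nonneg (Real.rpow_nonneg (hbc0 _) _) (hb j)),
      Real.norm_of_nonneg (Real.rpow_nonneg (hbc0 _) _)]
    have : S / Q = S / P + 1 := by
      rw [div_eq_mul_inv, h', mul_add, mul_inv_cancel₀ hs'.ne']; ring
    rw [this, Real.rpow_add' (hbc0 j) (by positivity), Real.rpow_one]
    field_simp
  rw [lpNorm_mul_left hq h0.le e, lpNorm_eq_sum hq hqt]
  simp_rw [Real.norm_of_nonneg (Real.rpow_nonneg (hbc0 _) _), ← Real.rpow_mul (hbc0 _)]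
  rw [show S / Q * q.toReal = S from div_mul_cancel₀ _ hq'.ne', hbc, Real.one_rpow, mul_one]

end LpNorm

/-! ### Anisotropic norms of arrays. -/

section MixedNorm

variable {E F : Type*} [NormedAddCommGroup E] [NormedAddCommGroup F] {n : ℕ}

lemma sum_fin_succ_fun {α M : Type*} [Fintype α] [AddCommMonoid M] {m : ℕ}
    (f : (Fin (m + 1) → α) → M) :
    ∑ J, f J = ∑ j, ∑ I : Fin m → α, f (Fin.cons j I) := by
  rw [← (Fin.consEquiv (fun _ : Fin (m + 1) => α)).sum_comp, Fintype.sum_prod_type]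
  rfl

lemma mixedNorm_zero_left {E : Type*} [Norm E] (s : Fin 0 → ℝ≥0∞) (a : (Fin 0 → Fin n) → E) :
    mixedNorm s a = ‖a Fin.elim0‖ := rfl

lemma mixedNorm_succ {E : Type*} [Norm E] {m : ℕ} (s : Fin (m + 1) → ℝ≥0∞)
    (a : (Fin (m + 1) → Fin n) → E) :
    mixedNorm s a = lpNorm (s 0) (fun j : Fin n =>
      mixedNorm (fun k => s k.succ) (fun I => a (Fin.cons j I))) := rfl

lemma mixedNorm_nonneg {m : ℕ} {s : Fin m → ℝ≥0∞} (hs : ∀ k, s k ≠ 0)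
    (a : (Fin m → Fin n) → E) : 0 ≤ mixedNorm s a := by
  cases m with
  | zero => exact norm_nonneg _
  | succ m => exact lpNorm_nonneg (hs 0) _

lemma mixedNorm_mono {m : ℕ} {s : Fin m → ℝ≥0∞} (hs : ∀ k, s k ≠ 0)
    {a : (Fin m → Fin n) → E} {b : (Fin m → Fin n) → F} (h : ∀ J, ‖a J‖ ≤ ‖b J‖) :
    mixedNorm s a ≤ mixedNorm s b := by
  induction m with
  | zero => exact h _
  | succ m ih =>
    refine lpNorm_mono (hs 0) fun j => ?_
    rw [Real.norm_of_nonneg (mixedNorm_nonneg (fun k => hs k.succ) _),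
      Real.norm_of_nonneg (mixedNorm_nonneg (fun k => hs k.succ) _)]
    exact ih (fun k => hs k.succ) fun I => h _

lemma mixedNorm_congr {m : ℕ} {s : Fin m → ℝ≥0∞} (hs : ∀ k, s k ≠ 0)
    {a : (Fin m → Fin n) → E} {b : (Fin m → Fin n) → F} (h : ∀ J, ‖a J‖ = ‖b J‖) :
    mixedNorm s a = mixedNorm s b :=
  le_antisymm (mixedNorm_mono hs fun J => (h J).le) (mixedNorm_mono hs fun J => (h J).ge)

lemma mixedNorm_mul_left {m : ℕ} {s : Fin m → ℝ≥0∞} (hs : ∀ k, s k ≠ 0) {c : ℝ} (hc : 0 ≤ c)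
    {a : (Fin m → Fin n) → E} {b : (Fin m → Fin n) → F} (h : ∀ J, ‖a J‖ = c * ‖b J‖) :
    mixedNorm s a = c * mixedNorm s b := by
  induction m with
  | zero => exact h _
  | succ m ih =>
    refine lpNorm_mul_left (hs 0) hc fun j => ?_
    rw [Real.norm_of_nonneg (mixedNorm_nonneg (fun k => hs k.succ) _),
      Real.norm_of_nonneg (mixedNorm_nonneg (fun k => hs k.succ) _)]
    exact ih (fun k => hs k.succ) fun I => h _

lemma mixedNorm_cons_mul {m : ℕ} {s : Fin (m + 1) → ℝ≥0∞} (hs : ∀ k, s k ≠ 0)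
    {f : Fin n → ℝ} (hf : ∀ j, 0 ≤ f j) {a : (Fin (m + 1) → Fin n) → E}
    {b : (Fin m → Fin n) → F} (h : ∀ j I, ‖a (Fin.cons j I)‖ = f j * ‖b I‖) :
    mixedNorm s a = lpNorm (s 0) f * mixedNorm (fun k => s k.succ) b := by
  have hb := mixedNorm_nonneg (fun k => hs k.succ) b
  rw [mixedNorm_succ, mul_comm]
  refine lpNorm_mul_left (hs 0) hb fun j => ?_
  rw [Real.norm_of_nonneg (mixedNorm_nonneg (fun k => hs k.succ) _), Real.norm_of_nonneg (hf j),
    mul_comm]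
  exact mixedNorm_mul_left (fun k => hs k.succ) (hf j) fun I => h j I

/-- Anisotropic norms are multiplicative on elementary tensors; this evaluates them on the extremal
forms. -/
lemma mixedNorm_prod {m : ℕ} {s : Fin m → ℝ≥0∞} (hs : ∀ k, s k ≠ 0)
    {f : Fin m → Fin n → ℝ} (hf : ∀ k j, 0 ≤ f k j) {a : (Fin m → Fin n) → E}
    (h : ∀ J, ‖a J‖ = ∏ k, f k (J k)) :
    mixedNorm s a = ∏ k, lpNorm (s k) (f k) := by
  rw [mixedNorm_congr hs (b := fun J => ∏ k, f k (J k)) fun J => by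
    rw [h, Real.norm_of_nonneg (prod_nonneg fun _ _ => hf _ _)]]
  clear h
  induction m with
  | zero => simp [mixedNorm_zero_left]
  | succ m ih =>
    rw [mixedNorm_cons_mul (b := fun I => ∏ k : Fin m, f k.succ (I k)) hs (hf 0),
      Fin.prod_univ_succ, ih (fun k => hs k.succ) (fun k => hf k.succ)]
    · exact fun _ => 0
    · intro j I
      simp only [Fin.prod_univ_succ, norm_mul, Fin.cons_zero, Fin.cons_succ]
      rw [Real.norm_of_nonneg (hf 0 j)]

lemma mixedNorm_sum_le {m : ℕ} {s : Fin m → ℝ≥0∞} (hs : ∀ k, 1 ≤ s k) {ι : Type*}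
    (t : Finset ι) (a : ι → (Fin m → Fin n) → E) :
    mixedNorm s (fun J => ∑ i ∈ t, a i J) ≤ ∑ i ∈ t, mixedNorm s (a i) := by
  induction m with
  | zero => exact norm_sum_le _ _
  | succ m ih =>
    have h0 : ∀ k, s k ≠ 0 := fun k => (zero_lt_one.trans_le (hs k)).ne'
    simp only [mixedNorm_succ]
    refine le_trans ?_ (lpNorm_sum_le (hs 0) _ _)
    refine lpNorm_mono (h0 0) fun j => ?_
    rw [Real.norm_of_nonneg (mixedNorm_nonneg (fun k => h0 k.succ) _),
      Real.norm_of_nonneg (sum_nonneg fun _ _ => mixedNorm_nonneg (fun k => h0 k.succ) _)]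
    exact ih (fun k => hs k.succ) fun i I => a i (Fin.cons j I)

/-- Minkowski's inequality for anisotropic norms. -/
lemma lpNorm_mixedNorm_le {m : ℕ} {s : Fin m → ℝ≥0∞} (hs : ∀ k, s k ≠ 0) {q : ℝ≥0∞} (hq : q ≠ 0)
    (hsq : ∀ k, s k ≤ q) {N : ℕ} (x : Fin N → (Fin m → Fin n) → E) :
    lpNorm q (fun j => mixedNorm s (x j)) ≤ mixedNorm s (fun J => lpNorm q (fun j => x j J)) := by
  induction m with
  | zero =>
    simp only [mixedNorm_zero_left]
    rw [Real.norm_of_nonneg (lpNorm_nonneg hq _)]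
    exact (lpNorm_congr hq (by simp)).le
  | succ m ih =>
    simp only [mixedNorm_succ]
    refine (lpNorm_lpNorm_le (hs 0) (hsq 0) _).trans ?_
    refine lpNorm_mono (hs 0) fun j => ?_
    rw [Real.norm_of_nonneg (mixedNorm_nonneg (fun k => hs k.succ) _),
      Real.norm_of_nonneg (lpNorm_nonneg hq _)]
    exact ih (fun k => hs k.succ) (fun k => hsq k.succ) _

lemma mixedNorm_two {m : ℕ} (a : (Fin m → Fin n) → E) :
    mixedNorm (fun _ => 2) a = √(∑ J, ‖a J‖ ^ 2) := by
  induction m with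
  | zero =>
    rw [mixedNorm_zero_left, Fintype.sum_unique, Real.sqrt_sq (norm_nonneg _)]
    congr
  | succ m ih =>
    rw [mixedNorm_succ, lpNorm_two, sum_fin_succ_fun]
    simp only [ih]
    congr 1
    refine sum_congr rfl fun j _ => ?_
    rw [Real.norm_of_nonneg (Real.sqrt_nonneg _), Real.sq_sqrt (by positivity)]

end MixedNorm

/-! ### Khinchine inequalities for Hilbert space valued sign sums. -/

section Khinchine

variable (𝕜 : Type*) [RCLike 𝕜]

/-- The sign `±1` encoded by a Boolean. -/
def sgn (b : Bool) : 𝕜 := if b then 1 else -1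

@[simp] lemma sgn_true : sgn 𝕜 true = 1 := rfl

@[simp] lemma sgn_false : sgn 𝕜 false = -1 := rfl

@[simp] lemma norm_sgn (b : Bool) : ‖sgn 𝕜 b‖ = 1 := by cases b <;> simp

variable {H : Type*} [NormedAddCommGroup H] [InnerProductSpace 𝕜 H]

/-- Conditioning on the first sign reduces moment estimates to a two-point inequality for u + v and
u - v. -/
lemma sum_sgn_succ {n : ℕ} (x : Fin (n + 1) → H) (g : H → ℝ) :
    ∑ ε : Fin (n + 1) → Bool, g (∑ j, sgn 𝕜 (ε j) • x j) =
      ∑ ε : Fin n → Bool, (g (∑ j, sgn 𝕜 (ε j) • x j.succ + x 0) +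
        g (∑ j, sgn 𝕜 (ε j) • x j.succ - x 0)) := by
  rw [sum_fin_succ_fun, sum_comm]
  refine sum_congr rfl fun ε _ => ?_
  simp only [Fin.sum_univ_succ, Fin.cons_zero, Fin.cons_succ, Fintype.sum_bool, sgn_true, one_smul,
    sgn_false, neg_smul]
  rw [add_comm (x 0), add_comm (-x 0), ← sub_eq_add_neg]

lemma sum_norm_sq_sgn {n : ℕ} (x : Fin n → H) :
    ∑ ε : Fin n → Bool, ‖∑ j, sgn 𝕜 (ε j) • x j‖ ^ 2 = 2 ^ n * ∑ j, ‖x j‖ ^ 2 := by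
  induction n with
  | zero => simp
  | succ n ih =>
    rw [sum_sgn_succ 𝕜 x (fun v => ‖v‖ ^ 2)]
    have : ∀ u v : H, ‖u + v‖ ^ 2 + ‖u - v‖ ^ 2 = 2 * ‖u‖ ^ 2 + 2 * ‖v‖ ^ 2 := fun u v => by
      rw [parallelogram_law_with_norm 𝕜 u v, mul_add]
    simp only [this, sum_add_distrib, ← mul_sum, ih, Fin.sum_univ_succ, sum_const, card_univ,
      Fintype.card_pi, Fintype.card_bool, prod_const, Fintype.card_fin, nsmul_eq_mul]
    push_cast
    ring

lemma sum_norm_pow_four_sgn_le {n : ℕ} (x : Fin n → H) :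
    ∑ ε : Fin n → Bool, ‖∑ j, sgn 𝕜 (ε j) • x j‖ ^ 4 ≤ 2 ^ n * (3 * (∑ j, ‖x j‖ ^ 2) ^ 2) := by
  induction n with
  | zero => simp
  | succ n ih =>
    rw [sum_sgn_succ 𝕜 x (fun v => ‖v‖ ^ 4)]
    have key : ∀ u v : H, ‖u + v‖ ^ 4 + ‖u - v‖ ^ 4 ≤
        2 * ‖u‖ ^ 4 + 12 * ‖v‖ ^ 2 * ‖u‖ ^ 2 + 2 * ‖v‖ ^ 4 := fun u v => by
      have h1 := parallelogram_law_with_norm 𝕜 u v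
      have h2 : |‖u + v‖ ^ 2 - ‖u - v‖ ^ 2| ≤ 4 * (‖u‖ * ‖v‖) := by
        rw [@norm_add_sq 𝕜, @norm_sub_sq 𝕜]
        have := RCLike.abs_re_le_norm (inner 𝕜 u v)
        have h3 := norm_inner_le_norm (𝕜 := 𝕜) u v
        rw [abs_le] at this ⊢
        constructor <;> linarith
      have h4 := sq_le_sq' (abs_le.1 h2).1 (abs_le.1 h2).2
      have h5 : (‖u + v‖ ^ 2 + ‖u - v‖ ^ 2) ^ 2 = (2 * (‖u‖ ^ 2 + ‖v‖ ^ 2)) ^ 2 := by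
        rw [h1]
      linear_combination (h4 + h5) / 2
    refine (sum_le_sum fun ε _ => key _ _).trans ?_
    simp only [sum_add_distrib, ← mul_sum, sum_norm_sq_sgn, sum_const, card_univ,
      Fintype.card_pi, Fintype.card_bool, prod_const, Fintype.card_fin, nsmul_eq_mul]
    have := ih (fun j => x j.succ)
    rw [Fin.sum_univ_succ (fun j => ‖x j‖ ^ 2)]
    set S := ∑ j : Fin n, ‖x j.succ‖ ^ 2
    have h2 : (0 : ℝ) ≤ 2 ^ n * ‖x 0‖ ^ 4 := by positivity
    push_cast
    rw [pow_succ]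
    linear_combination 2 * this + 4 * h2

/-- Khinchine's inequality between the first and the second moment, in a Hilbert space. -/
lemma lpNorm_two_le_sum_sgn {n : ℕ} (x : Fin n → H) :
    lpNorm 2 x ≤ ∑ ε : Fin n → Bool, √3 * (2 ^ n)⁻¹ * ‖∑ j, sgn 𝕜 (ε j) • x j‖ := by
  rw [lpNorm_two, ← mul_sum]
  have h2 := sum_norm_sq_sgn 𝕜 x
  have h4 := sum_norm_pow_four_sgn_le 𝕜 x
  set S := ∑ j, ‖x j‖ ^ 2 with hS
  have hS0 : 0 ≤ S := by positivity
  rcases hS0.eq_or_lt with h0 | h0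
  · rw [← h0, Real.sqrt_zero]; positivity
  set σ := √S with hσ
  have hσ0 : 0 < σ := Real.sqrt_pos.2 h0
  have hσ2 : σ ^ 2 = S := Real.sq_sqrt hS0
  have h3 : (√3 : ℝ) ^ 2 = 3 := Real.sq_sqrt (by norm_num)
  set s := √3 * σ with hs
  have hs0 : 0 < s := by positivity
  -- A pointwise bound, tangent at t = s, replaces interpolation between the moments 1, 2 and 4.
  -- With the fourth moment at most 3σ⁴, the choice s = √3 σ is optimal.
  have hpt : ∀ t : ℝ, 0 ≤ t → 3 * s ^ 2 * t ^ 2 - t ^ 4 ≤ 2 * s ^ 3 * t := fun t ht => by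
    have : 0 ≤ t * ((t - s) ^ 2 * (t + 2 * s)) := by positivity
    linear_combination this
  have := sum_le_sum fun (ε : Fin n → Bool) (_ : ε ∈ univ) =>
    hpt ‖∑ j, sgn 𝕜 (ε j) • x j‖ (norm_nonneg _)
  rw [sum_sub_distrib, ← mul_sum, ← mul_sum, h2] at this
  set T := ∑ ε : Fin n → Bool, ‖∑ j, sgn 𝕜 (ε j) • x j‖
  have hs2 : s ^ 2 = 3 * σ ^ 2 := by rw [hs, mul_pow, h3]
  have hs3 : s ^ 3 = 3 * √3 * σ ^ 3 := by rw [hs, mul_pow, pow_succ, h3]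
  rw [hs2, hs3, ← hσ2] at this
  rw [← hσ2] at h4
  have h6 : 2 ^ n * σ ^ 4 ≤ √3 * σ ^ 3 * T := by linarith
  have h7 : 2 ^ n * σ ≤ √3 * T := by
    have : 0 < σ ^ 3 := by positivity
    refine le_of_mul_le_mul_left ?_ this
    linarith
  rw [mul_assoc, mul_comm ((2 : ℝ) ^ n)⁻¹, ← mul_assoc, ← div_eq_mul_inv, le_div_iff₀ (by positivity)]
  linarith

/-- Khinchine's inequality for the square function in an anisotropic norm. -/
lemma mixedNorm_lpNorm_two_le {m n N : ℕ} {s : Fin m → ℝ≥0∞} (hs : ∀ k, 1 ≤ s k)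
    (x : Fin N → (Fin m → Fin n) → H) {M : ℝ}
    (hM : ∀ ε : Fin N → Bool, mixedNorm s (fun J => ∑ j, sgn 𝕜 (ε j) • x j J) ≤ M) :
    mixedNorm s (fun J => lpNorm 2 (fun j => x j J)) ≤ √3 * M := by
  have h0 : ∀ k, s k ≠ 0 := fun k => (zero_lt_one.trans_le (hs k)).ne'
  calc _ ≤ mixedNorm s (fun J => ∑ ε : Fin N → Bool,
          √3 * (2 ^ N)⁻¹ * ‖∑ j, sgn 𝕜 (ε j) • x j J‖) := by
        refine mixedNorm_mono h0 fun J => ?_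
        rw [Real.norm_of_nonneg (lpNorm_nonneg (by simp) _), Real.norm_of_nonneg (by positivity)]
        exact lpNorm_two_le_sum_sgn 𝕜 _
    _ ≤ ∑ ε : Fin N → Bool, √3 * (2 ^ N)⁻¹ *
          mixedNorm s (fun J => ∑ j, sgn 𝕜 (ε j) • x j J) := by
        refine (mixedNorm_sum_le hs _ _).trans (sum_le_sum fun ε _ => le_of_eq ?_)
        refine mixedNorm_mul_left h0 (by positivity) fun J => ?_
        rw [Real.norm_of_nonneg (by positivity)]
    _ ≤ ∑ ε : Fin N → Bool, √3 * (2 ^ N)⁻¹ * M := by gcongr; exact hM _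
    _ = √3 * M := by
        simp only [sum_const, card_univ, Fintype.card_pi, Fintype.card_bool, prod_const,
          Fintype.card_fin, nsmul_eq_mul]
        push_cast
        field_simp

/-- Khinchine's inequality for multilinear sign polynomials with values in `ℓ₁`. -/
lemma sum_sqrt_le_of_sgn {m n N : ℕ} (f : Fin N → (Fin m → Fin n) → H) {M : ℝ}
    (hM : ∀ ε : Fin m → Fin n → Bool,
      ∑ j, ‖∑ I : Fin m → Fin n, (∏ k, sgn 𝕜 (ε k (I k))) • f j I‖ ≤ M) :
    ∑ j, √(∑ I, ‖f j I‖ ^ 2) ≤ √3 ^ m * M := by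
  induction m generalizing H M with
  | zero =>
    refine le_trans (le_of_eq ?_) ((hM Fin.elim0).trans_eq (by simp))
    refine sum_congr rfl fun j _ => ?_
    simp [Real.sqrt_sq (norm_nonneg _)]
  | succ m ih =>
    -- The first index is absorbed into an ℓ₂ sum of copies of H, which is again a Hilbert space;
    -- hence the induction over varying H.
    let f' : Fin N → (Fin m → Fin n) → PiLp 2 (fun _ : Fin n => H) := fun j I =>
      WithLp.toLp 2 (fun k => f j (Fin.cons k I))
    have := ih f' (M := √3 * M) fun ε => by
      have e : ∀ j, ‖∑ I : Fin m → Fin n, (∏ k, sgn 𝕜 (ε k (I k))) • f' j I‖ =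
          lpNorm 2 (fun l => ∑ I : Fin m → Fin n,
            (∏ k, sgn 𝕜 (ε k (I k))) • f j (Fin.cons l I)) := fun j => by
        rw [lpNorm]
        congr 1
        ext l
        simp [f']
      simp only [e]
      calc _ ≤ ∑ j, ∑ ε' : Fin n → Bool, √3 * (2 ^ n)⁻¹ * ‖∑ l, sgn 𝕜 (ε' l) •
              ∑ I : Fin m → Fin n, (∏ k, sgn 𝕜 (ε k (I k))) • f j (Fin.cons l I)‖ :=
            sum_le_sum fun j _ => lpNorm_two_le_sum_sgn 𝕜 _
        _ = ∑ ε' : Fin n → Bool, √3 * (2 ^ n)⁻¹ * ∑ j, ‖∑ l, sgn 𝕜 (ε' l) •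
              ∑ I : Fin m → Fin n, (∏ k, sgn 𝕜 (ε k (I k))) • f j (Fin.cons l I)‖ := by
            rw [sum_comm]
            simp only [mul_sum]
        _ ≤ ∑ ε' : Fin n → Bool, √3 * (2 ^ n)⁻¹ * M := by
            gcongr with ε'
            refine le_trans (le_of_eq ?_) (hM (Fin.cons ε' ε))
            refine sum_congr rfl fun j _ => ?_
            rw [sum_fin_succ_fun]
            simp only [Fin.prod_univ_succ, Fin.cons_zero, Fin.cons_succ, mul_smul, smul_sum]
        _ = √3 * M := by
            simp only [sum_const, card_univ, Fintype.card_pi, Fintype.card_bool, prod_const,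
              Fintype.card_fin, nsmul_eq_mul]
            push_cast
            field_simp
    rw [pow_succ, mul_assoc]
    refine le_trans (le_of_eq ?_) this
    refine sum_congr rfl fun j _ => ?_
    rw [sum_fin_succ_fun, sum_comm]
    simp [f', PiLp.norm_sq_eq_of_L2]

end Khinchine

/-! ### Upper estimates for multilinear forms. -/

section Forms

variable {𝕜 : Type*} [RCLike 𝕜] {m n : ℕ}

/-- The value at `z` of the multilinear form with coefficients `a`. -/
def arrayForm (a : (Fin m → Fin n) → 𝕜) (z : Fin m → Fin n → 𝕜) : 𝕜 :=
  ∑ J, a J * ∏ k, z k (J k)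

/-- `M` bounds the multilinear form with coefficients `a` on the product of the unit balls. -/
def IsFormBound (p : Fin m → ℝ≥0∞) (a : (Fin m → Fin n) → 𝕜) (M : ℝ) : Prop :=
  ∀ z : Fin m → Fin n → 𝕜, (∀ k, lpNorm (p k) (z k) ≤ 1) → ‖arrayForm a z‖ ≤ M

lemma IsFormBound.nonneg {p : Fin m → ℝ≥0∞} (hp : ∀ k, p k ≠ 0) {a : (Fin m → Fin n) → 𝕜} {M : ℝ}
    (h : IsFormBound p a M) : 0 ≤ M :=
  (norm_nonneg _).trans (h (fun _ _ => 0) fun k => by simp [lpNorm_zero (hp k)])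

lemma exists_mul_eq_norm (g : 𝕜) : ∃ c : 𝕜, ‖c‖ ≤ 1 ∧ c * g = (‖g‖ : 𝕜) := by
  rcases eq_or_ne g 0 with rfl | hg
  · exact ⟨0, by simp⟩
  · have hg' : (‖g‖ : 𝕜) ≠ 0 := by simpa using hg
    refine ⟨starRingEnd 𝕜 g / ‖g‖, by simp [hg], ?_⟩
    rw [div_mul_eq_mul_div, RCLike.conj_mul, pow_two, mul_div_assoc, div_self hg', mul_one]

lemma sum_insertNth {M : Type*} [AddCommMonoid M] (i : Fin (m + 1))
    (f : (Fin (m + 1) → Fin n) → M) :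
    ∑ J, f J = ∑ j, ∑ I : Fin m → Fin n, f (i.insertNth j I) := by
  rw [← (Fin.insertNthEquiv (fun _ => Fin n) i).sum_comp, Fintype.sum_prod_type]
  rfl

/-- The mixed `(ℓ₁, ℓ₂)` inequality for forms bounded on polydiscs. -/
lemma sum_sqrt_insertNth_le {a : (Fin (m + 1) → Fin n) → 𝕜} {M : ℝ}
    (h : ∀ z : Fin (m + 1) → Fin n → 𝕜, (∀ k j, ‖z k j‖ ≤ 1) → ‖arrayForm a z‖ ≤ M)
    (i : Fin (m + 1)) :
    ∑ j, √(∑ I, ‖a (i.insertNth j I)‖ ^ 2) ≤ √3 ^ m * M := by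
  refine sum_sqrt_le_of_sgn 𝕜 (fun j I => a (i.insertNth j I)) fun ε => ?_
  set g : Fin n → 𝕜 := fun j => ∑ I : Fin m → Fin n, (∏ k, sgn 𝕜 (ε k (I k))) •
    a (i.insertNth j I) with hg
  -- Slot i receives multipliers that align the phases, the other slots receive signs; the ℓ₁ sum
  -- becomes a value of the form.
  choose c hc1 hc2 using fun j => exists_mul_eq_norm (g j)
  have hz := h (i.insertNth c fun k j => sgn 𝕜 (ε k j)) fun k j => by
    rcases Fin.eq_self_or_eq_succAbove i k with rfl | ⟨k, rfl⟩
    · simpa using hc1 j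
    · simp
  have e : arrayForm a (i.insertNth c fun k j => sgn 𝕜 (ε k j)) = ((∑ j, ‖g j‖ : ℝ) : 𝕜) := by
    rw [arrayForm, sum_insertNth i]
    push_cast
    refine sum_congr rfl fun j _ => ?_
    refine Eq.trans ?_ (hc2 j)
    rw [hg, mul_sum]
    refine sum_congr rfl fun I _ => ?_
    rw [Fin.prod_univ_succAbove _ i]
    simp only [Fin.insertNth_apply_same, Fin.insertNth_apply_succAbove, smul_eq_mul]
    ring
  rw [e, RCLike.norm_ofReal, abs_of_nonneg (by positivity)] at hz
  exact hz

/-- Multiplying a vector of the unit ball of ℓ_p by one of sup norm at most 1 stays in the ball, so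
the weighted array is a form bounded on the polydisc. -/
lemma IsFormBound.sum_sqrt_weighted_le {p : Fin (m + 1) → ℝ≥0∞} (hp : ∀ k, p k ≠ 0)
    {a : (Fin (m + 1) → Fin n) → 𝕜} {M : ℝ} (h : IsFormBound p a M) {z : Fin (m + 1) → Fin n → ℝ}
    (hz : ∀ k, lpNorm (p k) (z k) ≤ 1) (i : Fin (m + 1)) :
    ∑ j, √(∑ I, (‖a (i.insertNth j I)‖ * ∏ k, z k ((i.insertNth j I : Fin (m + 1) → Fin n) k)) ^ 2)
      ≤ √3 ^ m * M := by
  have := sum_sqrt_insertNth_le (a := fun J => a J * ((∏ k, z k (J k) : ℝ) : 𝕜)) (M := M)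
    (fun y hy => ?_) i
  · refine this.trans_eq' (sum_congr rfl fun j _ => congrArg _ (sum_congr rfl fun I _ => ?_))
    rw [norm_mul, RCLike.norm_ofReal, mul_pow, mul_pow, sq_abs]
  · have := h (fun k j => (z k j : 𝕜) * y k j) fun k => by
      refine (lpNorm_mono (hp k) fun j => ?_).trans (hz k)
      rw [norm_mul, RCLike.norm_ofReal, Real.norm_eq_abs]
      exact mul_le_of_le_one_right (abs_nonneg _) (hy k j)
    refine le_of_eq_of_le (congrArg _ ?_) this
    rw [arrayForm, arrayForm]
    refine sum_congr rfl fun J _ => ?_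
    rw [prod_mul_distrib]
    push_cast
    ring

/-- The marginal distribution of the coordinate `k`. -/
def marginal (ν : (Fin (m + 1) → Fin n) → ℝ) (k : Fin (m + 1)) (j : Fin n) : ℝ :=
  ∑ I : Fin m → Fin n, ν (k.insertNth j I)

lemma marginal_nonneg {ν : (Fin (m + 1) → Fin n) → ℝ} (hν : ∀ J, 0 ≤ ν J) (k : Fin (m + 1))
    (j : Fin n) : 0 ≤ marginal ν k j :=
  sum_nonneg fun _ _ => hν _

lemma sum_marginal (ν : (Fin (m + 1) → Fin n) → ℝ) (k : Fin (m + 1)) :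
    ∑ j, marginal ν k j = ∑ J, ν J :=
  (sum_insertNth k ν).symm

lemma le_marginal {ν : (Fin (m + 1) → Fin n) → ℝ} (hν : ∀ J, 0 ≤ ν J) (J : Fin (m + 1) → Fin n)
    (k : Fin (m + 1)) : ν J ≤ marginal ν k (J k) := by
  have := single_le_sum (f := fun I => ν (k.insertNth (J k) I)) (fun _ _ => hν _)
    (mem_univ (k.removeNth J))
  rwa [Fin.insertNth_self_removeNth] at this

/-- Cauchy-Schwarz on each slice, whose total mass is the marginal. -/
lemma sum_mul_rpow_marginal_le {ν : (Fin (m + 1) → Fin n) → ℝ} (hν : ∀ J, 0 ≤ ν J)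
    {P : (Fin (m + 1) → Fin n) → ℝ} (i : Fin (m + 1)) :
    ∑ J, ν J * (P J * marginal ν i (J i) ^ (-(1 / 2) : ℝ)) ≤
      ∑ j, √(∑ I, ν (i.insertNth j I) * P (i.insertNth j I) ^ 2) := by
  rw [sum_insertNth i]
  refine sum_le_sum fun j _ => ?_
  simp only [Fin.insertNth_apply_same, ← mul_assoc]
  rw [← sum_mul]
  rcases (marginal_nonneg hν i j).eq_or_lt with hj | hj
  -- On an empty slice the convention 0 ^ (-1/2) = 0 applies.
  · rw [← hj, Real.zero_rpow (by norm_num), mul_zero]; positivity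
  · rw [Real.rpow_neg hj.le, ← Real.sqrt_eq_rpow, ← div_eq_mul_inv,
      div_le_iff₀ (Real.sqrt_pos.2 hj)]
    have cs := Real.sum_mul_le_sqrt_mul_sqrt univ
      (fun I => √(ν (i.insertNth j I)) * P (i.insertNth j I)) (fun I => √(ν (i.insertNth j I)))
    refine (le_of_eq ?_).trans (cs.trans_eq ?_)
    · refine sum_congr rfl fun I _ => ?_
      rw [mul_right_comm, Real.mul_self_sqrt (hν _)]
    · simp only [mul_pow, Real.sq_sqrt (hν _), marginal]

/-- A probability distribution weighted by powers of its marginals. -/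
lemma one_le_of_forall_sum_sqrt_marginal_le {ν : (Fin (m + 1) → Fin n) → ℝ} (hν : ∀ J, 0 ≤ ν J)
    (hν1 : ∑ J, ν J = 1) {e : Fin (m + 1) → ℝ} (he0 : ∀ k, 0 ≤ e k) (he : ∑ k, 2 * e k = 1)
    {P : (Fin (m + 1) → Fin n) → ℝ} (hP : ∀ J, P J = ∏ k, marginal ν k (J k) ^ e k) {K : ℝ}
    (hK : ∀ i : Fin (m + 1), ∑ j, √(∑ I, ν (i.insertNth j I) * P (i.insertNth j I) ^ 2) ≤ K) :
    1 ≤ K := by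
  have hμ0 := marginal_nonneg hν
  have hP0 : ∀ J, 0 ≤ P J := fun J => by
    rw [hP]
    exact prod_nonneg fun k _ => Real.rpow_nonneg (hμ0 _ _) _
  let X : Fin (m + 1) → (Fin (m + 1) → Fin n) → ℝ := fun i J =>
    P J * (marginal ν i (J i) ^ (-(1 / 2) : ℝ))
  have hX0 : ∀ i J, 0 ≤ X i J := fun i J => mul_nonneg (hP0 J) (Real.rpow_nonneg (hμ0 _ _) _)
  have hone : ∀ J, ν J ≤ ∑ i, 2 * e i * (ν J * X i J) := fun J => by
    rcases (hν J).eq_or_lt with hJ | hJ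
    · simp [← hJ]
    have hpos : ∀ k, 0 < marginal ν k (J k) := fun k => hJ.trans_le (le_marginal hν J k)
    have hPpos : 0 < P J := by
      rw [hP]
      exact prod_pos fun k _ => Real.rpow_pos_of_pos (hpos k) _
    have amgm := Real.geom_mean_le_arith_mean_weighted univ (fun i => 2 * e i) (fun i => X i J)
      (fun i _ => by have := he0 i; positivity) he (fun i _ => hX0 i J)
    have e3 : ∀ i, X i J ^ (2 * e i) = P J ^ (2 * e i) * (marginal ν i (J i) ^ e i)⁻¹ := fun i => by
      rw [Real.mul_rpow hPpos.le (Real.rpow_nonneg (hμ0 _ _) _), ← Real.rpow_mul (hμ0 _ _),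
        ← Real.rpow_neg (hμ0 _ _)]
      congr 2
      ring
    -- The weights 2 e_i sum to 1, so the powers of P combine to P = ∏ μ_i^{e_i}, which the factors
    -- μ_i^{-e_i} cancel.
    have e2 : ∏ i, X i J ^ (2 * e i) = 1 := by
      simp only [e3]
      rw [prod_mul_distrib, ← Real.rpow_sum_of_pos hPpos, he, Real.rpow_one, prod_inv_distrib, ← hP]
      exact mul_inv_cancel₀ hPpos.ne'
    rw [e2] at amgm
    calc ν J = ν J * 1 := (mul_one _).symm
      _ ≤ ν J * ∑ i, 2 * e i * X i J := by gcongr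
      _ = _ := by
        rw [mul_sum]
        exact sum_congr rfl fun i _ => by ring
  calc 1 = ∑ J, ν J := hν1.symm
    _ ≤ ∑ J, ∑ i, 2 * e i * (ν J * X i J) := sum_le_sum fun J _ => hone J
    _ = ∑ i, 2 * e i * ∑ J, ν J * X i J := by
        rw [sum_comm]
        exact sum_congr rfl fun i _ => (mul_sum _ _ _).symm
    _ ≤ ∑ i, 2 * e i * K := by
        refine sum_le_sum fun i _ => mul_le_mul_of_nonneg_left ?_ (by have := he0 i; positivity)
        exact (sum_mul_rpow_marginal_le hν i).trans (hK i)
    _ = K := by rw [← sum_mul, he, one_mul]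

/-- The Hardy-Littlewood inequality in `ℓ₂` when the reciprocals of the exponents add up
to `1 / 2`. -/
lemma sqrt_sum_le_of_sum_inv_eq_half {p : Fin (m + 1) → ℝ≥0∞} (hp : ∀ k, p k ≠ 0)
    (hsum : ∑ k, (p k)⁻¹ = 2⁻¹) {a : (Fin (m + 1) → Fin n) → 𝕜} {M : ℝ} (h : IsFormBound p a M) :
    √(∑ J, ‖a J‖ ^ 2) ≤ √3 ^ m * M := by
  have hM := h.nonneg hp
  set S := ∑ J, ‖a J‖ ^ 2 with hS
  have hS0 : 0 ≤ S := by positivity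
  rcases hS0.eq_or_lt with h0 | h0
  · rw [← h0, Real.sqrt_zero]; positivity
  obtain ⟨ν, hν⟩ : ∃ ν : (Fin (m + 1) → Fin n) → ℝ, ∀ J, ν J = ‖a J‖ ^ 2 / S := ⟨_, fun _ => rfl⟩
  have hν0 : ∀ J, 0 ≤ ν J := fun J => by rw [hν]; positivity
  have hν1 : ∑ J, ν J = 1 := by simp only [hν]; rw [← sum_div, div_self h0.ne']
  have hμ0 := marginal_nonneg hν0
  obtain ⟨e, he⟩ : ∃ e : Fin (m + 1) → ℝ, ∀ k, e k = ((p k)⁻¹).toReal := ⟨_, fun _ => rfl⟩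
  have he1 : ∑ k, 2 * e k = 1 := by
    simp only [he]
    rw [← mul_sum, ← ENNReal.toReal_sum (fun k _ => by simpa using hp k), hsum]
    simp
  have hz : ∀ k, lpNorm (p k) (fun j => marginal ν k j ^ e k) ≤ 1 := fun k => by
    rcases eq_or_ne (p k) ∞ with ht | ht
    · rw [ht, lpNorm_top]
      exact Real.iSup_le (fun j => by simp [he, ht]) zero_le_one
    · have hp' := ENNReal.toReal_pos (hp k) ht
      rw [lpNorm_eq_sum (hp k) ht]
      simp_rw [Real.norm_of_nonneg (Real.rpow_nonneg (hμ0 _ _) _), ← Real.rpow_mul (hμ0 _ _)]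
      have : e k * (p k).toReal = 1 := by
        simp [he, ENNReal.toReal_inv, hp'.ne']
      simp [this, sum_marginal, hν1]
  have key := one_le_of_forall_sum_sqrt_marginal_le hν0 hν1 (e := e)
    (fun k => by rw [he]; exact ENNReal.toReal_nonneg) he1 (P := fun J => ∏ k, marginal ν k (J k) ^ e k)
    (fun _ => rfl) (K := √3 ^ m * M / √S) fun i => ?_
  · rwa [le_div_iff₀ (Real.sqrt_pos.2 h0), one_mul] at key
  · rw [le_div_iff₀ (Real.sqrt_pos.2 h0)]
    refine (h.sum_sqrt_weighted_le hp hz i).trans_eq' ?_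
    rw [sum_mul]
    refine sum_congr rfl fun j _ => ?_
    rw [← Real.sqrt_mul' _ hS0, sum_mul]
    congr 1
    refine sum_congr rfl fun I _ => ?_
    rw [hν, mul_pow]
    field_simp

lemma arrayForm_cons (a : (Fin (m + 1) → Fin n) → 𝕜) (w : Fin n → 𝕜) (z : Fin m → Fin n → 𝕜) :
    arrayForm a (Fin.cons w z) = arrayForm (fun I => ∑ j, w j * a (Fin.cons j I)) z := by
  rw [arrayForm, arrayForm, sum_fin_succ_fun, sum_comm]
  refine sum_congr rfl fun I _ => ?_
  rw [sum_mul]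
  refine sum_congr rfl fun j _ => ?_
  rw [Fin.prod_univ_succ]
  simp only [Fin.cons_zero, Fin.cons_succ]
  ring

/-- The Hardy-Littlewood inequality with all inner exponents equal to `2`. -/
lemma mixedNorm_le_of_inner_two {p s : Fin (m + 1) → ℝ≥0∞} (hp : ∀ k, p k ≠ 0)
    (h1 : ∑ k : Fin m, (p k.succ)⁻¹ < 2⁻¹) (h2 : 2⁻¹ ≤ ∑ k, (p k)⁻¹) (h3 : ∑ k, (p k)⁻¹ ≤ 1)
    (hs0 : s 0 = (1 - ∑ k, (p k)⁻¹)⁻¹) (hs : ∀ k : Fin m, s k.succ = 2)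
    {a : (Fin (m + 1) → Fin n) → 𝕜} {M : ℝ} (h : IsFormBound p a M) :
    mixedNorm s a ≤ √3 ^ m * M := by
  have hM := h.nonneg hp
  have hT := Fin.sum_univ_succ fun k => (p k)⁻¹
  set T₁ := ∑ k : Fin m, (p k.succ)⁻¹
  set T₀ := ∑ k, (p k)⁻¹
  -- The part α of 1/p_0 = β + α completes the sum to 1/2; the excess β goes to the multiplier.
  set α : ℝ≥0∞ := 2⁻¹ - T₁ with hα
  set β : ℝ≥0∞ := T₀ - 2⁻¹ with hβ
  have hT0 : T₀ ≠ ∞ := ne_top_of_le_ne_top (by simp) h3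
  have hT1 : T₁ ≠ ∞ := h1.ne_top
  have hα1 : α + T₁ = 2⁻¹ := tsub_add_cancel_of_le h1.le
  have hβ1 : β + 2⁻¹ = T₀ := tsub_add_cancel_of_le h2
  have hα0 : α ≠ ∞ := by simp [hα]
  have hβ0 : β ≠ ∞ := ENNReal.sub_ne_top hT0
  have hαβ : (p 0)⁻¹ = β + α := by
    refine (ENNReal.add_left_inj hT1).1 ?_
    rw [← hT, add_assoc, hα1, hβ1]
  rw [mixedNorm_succ]
  have hs' : (fun k : Fin m => s k.succ) = fun _ => 2 := funext hs
  rw [hs']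
  have hs00 : s 0 ≠ 0 := by simp [hs0]
  refine lpNorm_le_of_forall_mul (p := β⁻¹) (q := 2) (by simpa) (by simp) hs00 ?_
    (fun j => mixedNorm_nonneg (by simp) _) (by positivity) fun w hw0 hw => ?_
  · rw [hs0, inv_inv, inv_inv]
    refine (ENNReal.add_left_inj (by simp : (2⁻¹ : ℝ≥0∞) ≠ ∞)).1 ?_
    rw [add_assoc, hβ1, tsub_add_cancel_of_le h3, ENNReal.inv_two_add_inv_two]
  -- By Hölder, w in the ball of ℓ_{1/β} maps the ball of ℓ_{1/α} into that of ℓ_{p_0}.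
  · have key := sqrt_sum_le_of_sum_inv_eq_half (p := Fin.cons α⁻¹ fun k => p k.succ)
      (a := fun J => (w (J 0) : 𝕜) * a J) (M := M)
      (fun k => by cases k using Fin.cases <;> simp [hα0, hp])
      (by rw [Fin.sum_univ_succ]; simpa using hα1) (fun z hz => by
        have hz0 : lpNorm (p 0) (fun j => (w j : 𝕜) * z 0 j) ≤ 1 := by
          refine (lpNorm_mul_le (p := β⁻¹) (q := α⁻¹) (by simpa) (by simpa) (hp 0)
            (by rw [hαβ, inv_inv, inv_inv]) _ _).trans ?_
          rw [lpNorm_congr (y := w) (by simpa) (by simp)]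
          exact mul_le_one₀ hw (lpNorm_nonneg (by simpa) _) (hz 0)
        have := h (Fin.cons (fun j => (w j : 𝕜) * z 0 j) fun k => z k.succ) (fun k => by
          cases k using Fin.cases with
          | zero => exact hz0
          | succ k => exact hz k.succ)
        refine le_of_eq_of_le (congrArg _ (sum_congr rfl fun J _ => ?_)) this
        rw [Fin.prod_univ_succ, Fin.prod_univ_succ]
        simp only [Fin.cons_zero, Fin.cons_succ]
        ring)
    refine le_trans (le_of_eq ?_) key
    rw [lpNorm_two, sum_fin_succ_fun]
    congr 1
    refine sum_congr rfl fun j _ => ?_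
    rw [mixedNorm_two, norm_mul, Real.norm_of_nonneg (Real.sqrt_nonneg _), mul_pow,
      Real.sq_sqrt (by positivity), mul_sum]
    simp [mul_pow]

lemma tailSum_eq_sum_ite (p : Fin m → ℝ≥0∞) (k : Fin m) :
    tailSum p k = ∑ i, if k ≤ i then (p i)⁻¹ else 0 := by
  rw [tailSum, ← sum_filter]
  simp only [one_div]
  congr 1
  ext i
  simp

lemma tailSum_zero (p : Fin (m + 1) → ℝ≥0∞) : tailSum p 0 = ∑ i, (p i)⁻¹ := by
  simp [tailSum_eq_sum_ite]

lemma tailSum_succ (p : Fin (m + 1) → ℝ≥0∞) (k : Fin m) :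
    tailSum p k.succ = tailSum (fun i => p i.succ) k := by
  simp [tailSum_eq_sum_ite, Fin.sum_univ_succ]

lemma tailSum_anti (p : Fin m → ℝ≥0∞) : Antitone (tailSum p) := fun _ _ h =>
  sum_le_sum_of_subset (Ici_subset_Ici.2 h)

lemma two_le_exponents {p : Fin m → ℝ≥0∞} {k₀ : Fin m} (h : 2⁻¹ ≤ tailSum p k₀) (k : Fin m) :
    2 ≤ exponents p k₀ k := by
  rw [exponents]
  split_ifs with hk
  · rw [ENNReal.le_inv_iff_le_inv]
    refine tsub_le_iff_right.2 ?_
    rw [← ENNReal.inv_two_add_inv_two]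
    gcongr
    exact h.trans (tailSum_anti p hk)
  · exact le_rfl

lemma exponents_le_exponents_zero {p : Fin (m + 1) → ℝ≥0∞} {k₀ : Fin (m + 1)}
    (h : 2⁻¹ ≤ tailSum p k₀) (k : Fin (m + 1)) : exponents p k₀ k ≤ exponents p k₀ 0 := by
  by_cases hk : k ≤ k₀
  · rw [exponents, exponents, if_pos hk, if_pos (Fin.zero_le _)]
    gcongr
    exact tailSum_anti p (Fin.zero_le _)
  · refine le_trans ?_ (two_le_exponents h 0)
    rw [exponents, if_neg hk]

/-- The induction removes the first slot, so only the bound ∑ 1/p_k ≤ 1 survives; equality would not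
be inherited. -/
theorem mixedNorm_exponents_le {p : Fin m → ℝ≥0∞} (hp : ∀ k, p k ≠ 0) (h1 : ∑ k, (p k)⁻¹ ≤ 1)
    {k₀ : Fin m} (hk : IsGreatest {t : Fin m | 2⁻¹ ≤ tailSum p t} k₀)
    {a : (Fin m → Fin n) → 𝕜} {M : ℝ} (h : IsFormBound p a M) :
    mixedNorm (exponents p k₀) a ≤ √3 ^ m * M := by
  induction m with
  | zero => exact k₀.elim0
  | succ m ih =>
    have hM := h.nonneg hp
    induction k₀ using Fin.cases with
    | zero =>
      have hT : ∑ k : Fin m, (p k.succ)⁻¹ < 2⁻¹ := by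
        cases m with
        | zero => simp
        | succ m =>
          by_contra hcon
          rw [not_lt, ← tailSum_zero (fun k => p k.succ), ← tailSum_succ] at hcon
          exact absurd (hk.2 hcon) (by simp)
      have h13 : (1 : ℝ) ≤ √3 := Real.one_le_sqrt.2 (by norm_num)
      refine (mixedNorm_le_of_inner_two hp hT (by rw [← tailSum_zero]; exact hk.1) h1 ?_ ?_ h).trans ?_
      · simp [exponents, tailSum_zero]
      · intro k
        rw [exponents, if_neg (by simp)]
      · gcongr
        · exact Nat.le_succ m
    | succ k₀ =>
      obtain ⟨m, rfl⟩ : ∃ m', m = m' + 1 := ⟨m - 1, by have := k₀.pos; omega⟩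
      have hT := Fin.sum_univ_succ fun k => (p k)⁻¹
      have hT' := tailSum_zero fun k : Fin (m + 1) => p k.succ
      have hk1 : 2⁻¹ ≤ tailSum (fun k => p k.succ) k₀ := by
        rw [← tailSum_succ]; exact hk.1
      set s := exponents (fun k => p k.succ) k₀ with hs
      have hs2 : ∀ k, 2 ≤ s k := two_le_exponents hk1
      have hs1 : ∀ k, 1 ≤ s k := fun k => le_trans (by norm_num) (hs2 k)
      have hs0 : ∀ k, s k ≠ 0 := fun k => (zero_lt_one.trans_le (hs1 k)).ne'
      have hss : (fun k : Fin (m + 1) => exponents p k₀.succ k.succ) = s := by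
        ext k
        simp [s, exponents, tailSum_succ]
      have hsq : ∀ k, s k ≤ s 0 := exponents_le_exponents_zero hk1
      have ih' : ∀ w : Fin n → 𝕜, lpNorm (p 0) w ≤ 1 →
          mixedNorm s (fun I => ∑ j, w j * a (Fin.cons j I)) ≤ √3 ^ (m + 1) * M := fun w hw => by
        refine ih (fun k => hp k.succ) (h1.trans' (by rw [hT]; exact le_add_self)) ⟨hk1, ?_⟩ ?_
        · intro t ht
          have : t.succ ≤ k₀.succ := hk.2 (by simpa [tailSum_succ] using ht)
          simpa using this
        · intro z hz
          rw [← arrayForm_cons]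
          exact h _ (Fin.cases (by simpa) fun k => by simpa using hz k)
      rw [mixedNorm_succ, hss]
      have hh1 : tailSum (fun k => p k.succ) 0 ≤ 1 := by
        rw [hT']; exact h1.trans' (by rw [hT]; exact le_add_self)
      have e0 : exponents p k₀.succ 0 = (1 - ∑ k, (p k)⁻¹)⁻¹ := by simp [exponents, tailSum_zero]
      have e1 : s 0 = (1 - ∑ k : Fin (m + 1), (p k.succ)⁻¹)⁻¹ := by simp [s, exponents, tailSum_zero]
      -- Duality in w, with the telescoping relation between consecutive exponents as the Hölder
      -- relation.
      refine lpNorm_le_of_forall_mul (p := p 0) (q := s 0) (hp 0) (hs0 0) (by simp [e0]) ?_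
        (fun j => mixedNorm_nonneg hs0 _) (by positivity) fun w hw0 hw => ?_
      · rw [e0, e1, inv_inv, inv_inv]
        refine (ENNReal.add_left_inj (a := ∑ k : Fin (m + 1), (p k.succ)⁻¹)
          (ne_top_of_le_ne_top (by simp) (hT' ▸ hh1))).1 ?_
        rw [tsub_add_cancel_of_le (hT' ▸ hh1), add_assoc, ← hT, tsub_add_cancel_of_le h1]
      · let x : Fin n → (Fin (m + 1) → Fin n) → 𝕜 := fun j I => (w j : 𝕜) * a (Fin.cons j I)
        calc _ = lpNorm (s 0) (fun j => mixedNorm s (x j)) := by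
              congr 1
              ext j
              exact (mixedNorm_mul_left hs0 (hw0 j) fun I => by
                simp [x, abs_of_nonneg (hw0 j)]).symm
          _ ≤ mixedNorm s (fun I => lpNorm (s 0) (fun j => x j I)) :=
              lpNorm_mixedNorm_le hs0 (hs0 0) hsq x
          _ ≤ mixedNorm s (fun I => lpNorm 2 (fun j => x j I)) := by
              refine mixedNorm_mono hs0 fun I => ?_
              rw [Real.norm_of_nonneg (lpNorm_nonneg (hs0 0) _),
                Real.norm_of_nonneg (lpNorm_nonneg (by simp) _)]
              exact lpNorm_anti (by simp) (hs2 0) _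
          _ ≤ √3 * (√3 ^ (m + 1) * M) := by
              refine mixedNorm_lpNorm_two_le 𝕜 hs1 x fun ε => ?_
              -- Signs do not change the norm of w, so the induction hypothesis holds uniformly in
              -- ε.
              refine le_of_eq_of_le ?_ (ih' (fun j => sgn 𝕜 (ε j) * (w j : 𝕜)) ?_)
              · simp only [x, smul_eq_mul, mul_assoc]
              · rwa [lpNorm_congr (y := w) (hp 0) (by simp)]
          _ = √3 ^ (m + 1 + 1) * M := by ring

end Forms

/-! ### Passage between forms and arrays; diagonal forms and the optimality of the first exponents.
-/

section Forms

variable {𝕜 : Type*} [RCLike 𝕜] {m n : ℕ}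

lemma multilinearMap_eq_arrayForm (A : MultilinearMap 𝕜 (fun _ : Fin m => Fin n → 𝕜) 𝕜)
    (z : Fin m → Fin n → 𝕜) :
    A z = arrayForm (fun J => A (fun k => Pi.single (J k) 1)) z := by
  have hz : z = fun k => ∑ j, z k j • (Pi.single j 1 : Fin n → 𝕜) := by
    ext k j
    simp [Finset.sum_apply, Pi.single_apply]
  conv_lhs => rw [hz]
  rw [MultilinearMap.map_sum, arrayForm]
  refine sum_congr rfl fun J _ => ?_
  rw [MultilinearMap.map_smul_univ, smul_eq_mul, mul_comm]

/-- The multilinear form with coefficients `a`. -/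
def formOfArray (a : (Fin m → Fin n) → 𝕜) : MultilinearMap 𝕜 (fun _ : Fin m => Fin n → 𝕜) 𝕜 :=
  ∑ J, a J • (MultilinearMap.mkPiAlgebra 𝕜 (Fin m) 𝕜).compLinearMap
    (fun k => LinearMap.proj (R := 𝕜) (φ := fun _ : Fin n => 𝕜) (J k))

lemma formOfArray_apply (a : (Fin m → Fin n) → 𝕜) (z : Fin m → Fin n → 𝕜) :
    formOfArray a z = arrayForm a z := by
  simp [formOfArray, arrayForm]

lemma arrayForm_single (a : (Fin m → Fin n) → 𝕜) (J : Fin m → Fin n) :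
    arrayForm a (fun k => Pi.single (J k) 1) = a J := by
  rw [arrayForm, sum_eq_single J]
  · simp
  · intro I _ hI
    obtain ⟨k, hk⟩ := Function.ne_iff.1 hI
    rw [prod_eq_zero (mem_univ k) (by simp [hk]), mul_zero]
  · simp

/-- The values on the unit balls are bounded by the sum of the moduli of the coefficients, so `sSup`
is a genuine supremum. -/
lemma isFormBound_formNorm {p : Fin m → ℝ≥0∞} (hp : ∀ k, p k ≠ 0)
    (A : MultilinearMap 𝕜 (fun _ : Fin m => Fin n → 𝕜) 𝕜) :
    IsFormBound p (fun J => A (fun k => Pi.single (J k) 1)) (formNorm p A) := by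
  intro z hz
  rw [← multilinearMap_eq_arrayForm]
  refine le_csSup ⟨∑ J : Fin m → Fin n, ‖A (fun k => Pi.single (J k) (1 : 𝕜))‖, ?_⟩ ⟨z, hz, rfl⟩
  rintro _ ⟨y, hy, rfl⟩
  rw [multilinearMap_eq_arrayForm]
  refine (norm_sum_le _ _).trans (sum_le_sum fun J _ => ?_)
  rw [norm_mul, norm_prod]
  exact mul_le_of_le_one_right (norm_nonneg _) (prod_le_one (fun _ _ => norm_nonneg _)
    fun k _ => (norm_apply_le_lpNorm (hp k) _ _).trans (hy k))

lemma hlInequalityWith_of_isFormBound {p t : Fin m → ℝ≥0∞} (hp : ∀ k, p k ≠ 0) {C : ℝ}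
    (h : ∀ (n : ℕ) (a : (Fin m → Fin n) → 𝕜) (M : ℝ), IsFormBound p a M → mixedNorm t a ≤ C * M) :
    HLInequalityWith 𝕜 p t C :=
  fun _ _ A => h _ _ _ (isFormBound_formNorm hp A)

lemma Admissible.exists_mixedNorm_le {p t : Fin m → ℝ≥0∞} (hp : ∀ k, p k ≠ 0)
    (h : Admissible 𝕜 p t) :
    ∃ C : ℝ, 0 ≤ C ∧ ∀ (n : ℕ), 0 < n → ∀ (a : (Fin m → Fin n) → 𝕜) (M : ℝ), IsFormBound p a M →
      mixedNorm t a ≤ C * M := by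
  obtain ⟨-, C, hC⟩ := h
  refine ⟨|C|, abs_nonneg C, fun n hn a M hM => ?_⟩
  have key := hC n hn (formOfArray a)
  simp only [formOfArray_apply, arrayForm_single] at key
  have h0 : 0 ≤ formNorm p (formOfArray a) := Real.sSup_nonneg (by
    rintro _ ⟨z, -, rfl⟩; exact norm_nonneg _)
  refine key.trans ((mul_le_mul_of_nonneg_right (le_abs_self C) h0).trans ?_)
  gcongr
  refine Real.sSup_le ?_ (hM.nonneg hp)
  rintro _ ⟨z, hz, rfl⟩
  rw [formOfArray_apply]
  exact hM z hz

lemma lpNorm_prod_le {p : Fin m → ℝ≥0∞} (hp : ∀ k, p k ≠ 0) (S : Finset (Fin m))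
    (x : Fin m → Fin n → ℝ) :
    lpNorm (∑ l ∈ S, (p l)⁻¹)⁻¹ (fun j => ∏ l ∈ S, x l j) ≤ ∏ l ∈ S, lpNorm (p l) (x l) := by
  induction S using Finset.induction_on with
  | empty => simpa [lpNorm_top] using Real.iSup_le (fun _ => le_rfl) zero_le_one
  | insert i S hi ih =>
    have hfin : ∀ S : Finset (Fin m), (∑ l ∈ S, (p l)⁻¹)⁻¹ ≠ 0 := fun S => by
      simp [ENNReal.inv_eq_zero, ENNReal.sum_eq_top, hp]
    simp only [prod_insert hi]
    refine (lpNorm_mul_le (hp i) (hfin S) (hfin _) ?_ _ _).trans ?_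
    · simp [sum_insert hi]
    · gcongr
      exact lpNorm_nonneg (hp i) _

/-- Powers dominate logarithms: half of a gap e - f > 0 absorbs the logarithm and the other half is
still unbounded. Lossy norm estimates therefore suffice for comparing exponents. -/
lemma le_of_forall_rpow_le {e f K : ℝ}
    (h : ∀ n : ℕ, 0 < n → (n : ℝ) ^ e ≤ K * ((n : ℝ) ^ f * (1 + Real.log n))) : e ≤ f := by
  by_contra! hlt
  set g := (e - f) / 2 with hg
  have hg0 : 0 < g := by rw [hg]; linarith
  have hK : 0 ≤ K := by
    have := h 1 one_pos
    simp at this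
    linarith
  have bound : ∀ n : ℕ, 0 < n → (n : ℝ) ^ g ≤ K * (1 + 1 / g) := fun n hn => by
    have hn' : (0 : ℝ) < n := Nat.cast_pos.2 hn
    have hn1 : (1 : ℝ) ≤ n := Nat.one_le_cast.2 hn
    have h1 : (1 : ℝ) ≤ (n : ℝ) ^ g := Real.one_le_rpow hn1 hg0.le
    have h2 := Real.log_le_rpow_div hn'.le hg0
    have h3 : (n : ℝ) ^ e = (n : ℝ) ^ f * ((n : ℝ) ^ g * (n : ℝ) ^ g) := by
      rw [← Real.rpow_add hn', ← Real.rpow_add hn']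
      congr 1
      rw [hg]; ring
    have hf : 0 < (n : ℝ) ^ f := Real.rpow_pos_of_pos hn' f
    have h4 := h n hn
    rw [h3, mul_left_comm K] at h4
    have h5 := le_of_mul_le_mul_left h4 hf
    have h6 : K * (1 + Real.log n) ≤ K * (1 + 1 / g) * (n : ℝ) ^ g := by
      rw [mul_assoc]
      gcongr
      rw [add_mul, one_mul, one_div, inv_mul_eq_div]
      gcongr
    exact le_of_mul_le_mul_right (h5.trans h6) (by positivity)
  have ht : Filter.Tendsto (fun n : ℕ => (n : ℝ) ^ g) Filter.atTop Filter.atTop :=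
    (tendsto_rpow_atTop hg0).comp tendsto_natCast_atTop_atTop
  obtain ⟨n, hn1, hn2⟩ := ((ht.eventually_gt_atTop (K * (1 + 1 / g))).and
    (Filter.eventually_gt_atTop 0)).exists
  exact absurd (bound n hn2) (not_le.2 hn1)

/-- The coefficients of the form `∏_{l < k} z_l(i) * ∑_j ∏_{l ≥ k} z_l(j)`. -/
def diagArray (𝕜 : Type*) [RCLike 𝕜] (i : Fin n) (k : Fin m) (J : Fin m → Fin n) : 𝕜 :=
  ∑ j, ∏ l, (Pi.single (if k ≤ l then j else i) 1 : Fin n → 𝕜) (J l)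

lemma arrayForm_diagArray (i : Fin n) (k : Fin m) (z : Fin m → Fin n → 𝕜) :
    arrayForm (diagArray 𝕜 i k) z = ∑ j, ∏ l, z l (if k ≤ l then j else i) := by
  simp only [arrayForm, diagArray, sum_mul, ← prod_mul_distrib]
  rw [sum_comm]
  refine sum_congr rfl fun j _ => ?_
  rw [← Fintype.prod_sum
    (fun l x => (Pi.single (if k ≤ l then j else i) 1 : Fin n → 𝕜) x * z l x)]
  refine prod_congr rfl fun l _ => ?_
  simp [Pi.single_apply]

lemma isFormBound_diagArray {p : Fin m → ℝ≥0∞} (hp : ∀ k, p k ≠ 0) {k : Fin m}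
    (hT : tailSum p k ≤ 1) (hn : 0 < n) (i : Fin n) :
    IsFormBound p (diagArray 𝕜 i k) ((n : ℝ) ^ (1 - tailSum p k).toReal) := by
  intro z hz
  rw [arrayForm_diagArray]
  have hT' : tailSum p k = ∑ l ∈ Ici k, (p l)⁻¹ := by simp [tailSum]
  have hTt : tailSum p k ≠ ∞ := ne_top_of_le_ne_top (by simp) hT
  have h1 : ∀ l j, ‖z l j‖ ≤ 1 := fun l j => (norm_apply_le_lpNorm (hp l) _ j).trans (hz l)
  calc ‖∑ j, ∏ l, z l (if k ≤ l then j else i)‖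
      ≤ ∑ j, ∏ l ∈ Ici k, ‖z l j‖ := by
        refine (norm_sum_le _ _).trans (sum_le_sum fun j _ => ?_)
        have e : ∏ l ∈ Ici k, ‖z l j‖ = ∏ l, if k ≤ l then ‖z l j‖ else 1 := by
          rw [← prod_filter]
          exact prod_congr (by ext; simp) fun _ _ => rfl
        rw [norm_prod, e]
        refine prod_le_prod (fun _ _ => norm_nonneg _) fun l _ => ?_
        split_ifs
        · exact le_rfl
        · exact h1 l i
    -- The constant factor 1 is inserted for Hölder; its norm supplies the power of n.
    _ = lpNorm 1 (fun j => (∏ l ∈ Ici k, ‖z l j‖) * (1 : ℝ)) := by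
        rw [lpNorm_one_eq]
        refine sum_congr rfl fun j _ => ?_
        rw [mul_one, Real.norm_of_nonneg (prod_nonneg fun _ _ => norm_nonneg _)]
    _ ≤ lpNorm (tailSum p k)⁻¹ (fun j => ∏ l ∈ Ici k, ‖z l j‖) *
          lpNorm (1 - tailSum p k)⁻¹ (fun _ : Fin n => (1 : ℝ)) := by
        refine lpNorm_mul_le (ENNReal.inv_ne_zero.2 hTt) (by simp) (by simp) ?_ _ _
        rw [inv_inv, inv_inv, add_tsub_cancel_of_le hT, inv_one]
    _ ≤ 1 * (n : ℝ) ^ (1 - tailSum p k).toReal := by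
        rw [lpNorm_of_norm_eq_one (p := (1 - tailSum p k)⁻¹) (by simp) hn (by simp), inv_inv]
        refine mul_le_mul_of_nonneg_right ?_ (by positivity)
        rw [hT']
        refine (lpNorm_prod_le hp _ _).trans (prod_le_one (fun l _ => lpNorm_nonneg (hp l) _) ?_)
        intro l _
        rw [lpNorm_congr (y := z l) (hp l) (by simp)]
        exact hz l
    _ = _ := one_mul _

lemma mixedNorm_diagArray {t : Fin m → ℝ≥0∞} (ht : ∀ k, t k ≠ 0) (hn : 0 < n) (i : Fin n)
    (k : Fin m) : mixedNorm t (diagArray 𝕜 i k) = (n : ℝ) ^ ((t k)⁻¹).toReal := by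
  induction m with
  | zero => exact k.elim0
  | succ m ih =>
    induction k using Fin.cases with
    | zero =>
      rw [mixedNorm_succ]
      refine lpNorm_of_norm_eq_one (ht 0) hn fun j => ?_
      rw [Real.norm_of_nonneg (mixedNorm_nonneg (fun k => ht k.succ) _),
        mixedNorm_prod (fun k => ht k.succ) (f := fun _ => Pi.single j 1)
          (fun _ l => by by_cases h : l = j <;> simp [h])]
      · simp [lpNorm_single, ht]
      · intro I
        simp only [diagArray, Fin.zero_le, if_true, Fin.prod_univ_succ, Fin.cons_zero, Fin.cons_succ]
        rw [sum_eq_single j (fun l _ hl => by simp [hl.symm]) (by simp)]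
        rw [Pi.single_eq_same, one_mul, norm_prod]
        refine prod_congr rfl fun l _ => ?_
        by_cases h : I l = j <;> simp [h]
    | succ k =>
      rw [mixedNorm_cons_mul ht (f := Pi.single i 1) (b := diagArray 𝕜 i k)
        (fun l => by by_cases h : l = i <;> simp [h]), lpNorm_single (ht 0), norm_one, one_mul,
        ih (fun k => ht k.succ)]
      intro j I
      have : diagArray 𝕜 i k.succ (Fin.cons j I) =
          (Pi.single i 1 : Fin n → 𝕜) j * diagArray 𝕜 i k I := by
        simp only [diagArray, Fin.prod_univ_succ, Fin.cons_zero, Fin.cons_succ, mul_sum]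
        simp
      rw [this, norm_mul]
      by_cases h : j = i <;> simp [h]

/-- The lower bound for the exponents of an admissible tuple. -/
lemma Admissible.inv_le {p t : Fin m → ℝ≥0∞} (hp : ∀ k, p k ≠ 0) (h : Admissible 𝕜 p t)
    {k : Fin m} (hT : tailSum p k ≤ 1) : (1 - tailSum p k)⁻¹ ≤ t k := by
  have ht : ∀ k, t k ≠ 0 := fun k => (h.1 k).ne'
  obtain ⟨C, hC0, hC⟩ := h.exists_mixedNorm_le hp
  have key : ((t k)⁻¹).toReal ≤ (1 - tailSum p k).toReal :=
    le_of_forall_rpow_le (K := C) fun n hn => by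
      have := hC n hn _ _ (isFormBound_diagArray (𝕜 := 𝕜) hp hT hn ⟨0, hn⟩)
      rw [mixedNorm_diagArray ht hn] at this
      refine this.trans ?_
      gcongr
      refine le_mul_of_one_le_right (by positivity) ?_
      have := Real.log_natCast_nonneg n
      linarith
  rw [ENNReal.inv_le_iff_inv_le]
  exact (ENNReal.toReal_le_toReal (by simpa using ht k)
    (ENNReal.sub_ne_top (by simp))).1 key

end Forms

/-! ### Random sign forms on Euclidean balls. -/

section RandomSigns

/-- Simultaneous control of finitely many sign sums, by the exponential moment method. -/
lemma exists_sum_sgn_le {ι T : Type*} [Fintype ι] [Fintype T] [DecidableEq T] {L r : ℝ}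
    (hr : 0 < r) (hL : (Fintype.card ι : ℝ) ≤ Real.exp L) (c : ι → T → ℝ)
    (hc : ∀ i, ∑ J, c i J ^ 2 ≤ 1) :
    ∃ ε : T → Bool, ∀ i, ∑ J, sgn ℝ (ε J) * c i J ≤ L / r + r / 2 := by
  have hsum : ∑ ε : T → Bool, ∑ i, Real.exp (r * ∑ J, sgn ℝ (ε J) * c i J) ≤
      ∑ _ε : T → Bool, Real.exp (L + r ^ 2 / 2) := by
    rw [sum_comm]
    have h1 : ∀ i, ∑ ε : T → Bool, Real.exp (r * ∑ J, sgn ℝ (ε J) * c i J) ≤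
        2 ^ Fintype.card T * Real.exp (r ^ 2 / 2) := fun i => by
      calc _ = ∑ ε : T → Bool, ∏ J, Real.exp (r * (sgn ℝ (ε J) * c i J)) := by
            simp only [mul_sum, Real.exp_sum]
        _ = ∏ J, ∑ b : Bool, Real.exp (r * (sgn ℝ b * c i J)) :=
            (Fintype.prod_sum fun J b => Real.exp (r * (sgn ℝ b * c i J))).symm
        _ ≤ ∏ J, 2 * Real.exp ((r * c i J) ^ 2 / 2) := by
            refine prod_le_prod (fun _ _ => by positivity) fun J _ => ?_
            -- Averaging over one sign gives cosh, so the sums are sub-Gaussian.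
            have := Real.cosh_le_exp_half_sq (r * c i J)
            rw [Real.cosh_eq] at this
            simp only [Fintype.sum_bool, sgn_true, sgn_false, one_mul, neg_mul, mul_neg]
            linarith
        _ = 2 ^ Fintype.card T * Real.exp (r ^ 2 / 2 * ∑ J, c i J ^ 2) := by
            rw [prod_mul_distrib, ← Real.exp_sum, mul_sum]
            simp only [prod_const, card_univ]
            congr 2
            exact sum_congr rfl fun J _ => by ring
        _ ≤ _ := by
            gcongr
            exact mul_le_of_le_one_right (by positivity) (hc i)
    calc _ ≤ ∑ _i : ι, 2 ^ Fintype.card T * Real.exp (r ^ 2 / 2) := sum_le_sum fun i _ => h1 i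
      _ = 2 ^ Fintype.card T * (Fintype.card ι * Real.exp (r ^ 2 / 2)) := by
          simp only [sum_const, card_univ, nsmul_eq_mul]; ring
      _ ≤ 2 ^ Fintype.card T * (Real.exp L * Real.exp (r ^ 2 / 2)) := by gcongr
      _ = _ := by simp [Real.exp_add]
  obtain ⟨ε, -, hε⟩ := exists_le_of_sum_le univ_nonempty hsum
  refine ⟨ε, fun i => ?_⟩
  have h2 := (single_le_sum (f := fun i => Real.exp (r * ∑ J, sgn ℝ (ε J) * c i J))
    (fun _ _ => (Real.exp_pos _).le) (mem_univ i)).trans hε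
  have h3 := Real.exp_le_exp.1 h2
  rw [div_add_div _ _ hr.ne' two_ne_zero, le_div_iff₀ (by positivity)]
  linarith

lemma norm_I_le_one {𝕜 : Type*} [RCLike 𝕜] : ‖(RCLike.I : 𝕜)‖ ≤ 1 := by
  by_cases h : (RCLike.I : 𝕜) = 0
  · simp [h]
  · exact (RCLike.norm_I_of_ne_zero h).le

/-- Each scalar sum is controlled by four real ones, ± its real and imaginary parts. Since 4 ≤ e²,
this replaces L by L + 2. -/
lemma exists_norm_sum_sgn_le {𝕜 : Type*} [RCLike 𝕜] {ι T : Type*} [Fintype ι] [Fintype T]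
    [DecidableEq T] {L r : ℝ} (hr : 0 < r) (hL : (Fintype.card ι : ℝ) ≤ Real.exp L)
    (c : ι → T → 𝕜) (hc : ∀ i, ∑ J, ‖c i J‖ ^ 2 ≤ 1) :
    ∃ ε : T → Bool, ∀ i, ‖∑ J, sgn 𝕜 (ε J) * c i J‖ ≤ 2 * ((L + 2) / r + r / 2) := by
  obtain ⟨ε, hε⟩ := exists_sum_sgn_le (ι := ι × Bool × Bool) (L := L + 2) hr (by
    have h4 : (4 : ℝ) ≤ Real.exp 2 := by
      have h2 := Real.add_one_le_exp (1 : ℝ)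
      have : Real.exp 2 = Real.exp 1 * Real.exp 1 := by rw [← Real.exp_add]; norm_num
      nlinarith
    rw [Real.exp_add]
    simp only [Fintype.card_prod, Fintype.card_bool]
    push_cast
    gcongr)
    (fun i J => sgn ℝ i.2.1 * if i.2.2 then RCLike.re (c i.1 J) else RCLike.im (c i.1 J))
    (fun i => by
      refine (hc i.1).trans' (sum_le_sum fun J _ => ?_)
      rw [mul_pow, ← sq_abs (sgn ℝ i.2.1), ← Real.norm_eq_abs, norm_sgn, one_pow, one_mul,
        RCLike.norm_sq_eq_def]
      split_ifs
      · nlinarith [mul_self_nonneg (RCLike.im (c i.1 J))]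
      · nlinarith [mul_self_nonneg (RCLike.re (c i.1 J))])
  refine ⟨ε, fun i => ?_⟩
  have hs : ∀ (b : Bool) (x : 𝕜), RCLike.re (sgn 𝕜 b * x) = sgn ℝ b * RCLike.re x ∧
      RCLike.im (sgn 𝕜 b * x) = sgn ℝ b * RCLike.im x := fun b x => by cases b <;> simp
  have h1 := hε (i, true, true)
  have h2 := hε (i, false, true)
  have h3 := hε (i, true, false)
  have h4 := hε (i, false, false)
  simp only [sgn_true, sgn_false, if_true, one_mul, neg_mul, mul_neg, sum_neg_distrib,
    Bool.false_eq_true, if_false] at h1 h2 h3 h4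
  rw [two_mul, ← RCLike.re_add_im (∑ J, sgn 𝕜 (ε J) * c i J)]
  refine (norm_add_le _ _).trans ?_
  rw [norm_mul, RCLike.norm_ofReal, RCLike.norm_ofReal]
  refine (add_le_add_right (mul_le_of_le_one_right (abs_nonneg _) norm_I_le_one) _).trans ?_
  simp only [map_sum, hs]
  exact add_le_add (abs_le.2 ⟨by linarith, h1⟩) (abs_le.2 ⟨by linarith, h3⟩)

/-- Rounding towards zero never increases the modulus, so discretised vectors remain in the unit
ball. -/
lemma exists_int_div_near {M : ℕ} (hM : 0 < M) {x : ℝ} (hx : |x| ≤ 1) :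
    ∃ u ∈ Finset.Icc (-(M : ℤ)) M, |(u : ℝ) / M| ≤ |x| ∧ |x - (u : ℝ) / M| ≤ 1 / M := by
  have hM' : (0 : ℝ) < M := Nat.cast_pos.2 hM
  wlog h : 0 ≤ x generalizing x
  · obtain ⟨u, hu, h1, h2⟩ := this (x := -x) (by rwa [abs_neg]) (by linarith)
    refine ⟨-u, by simp only [Finset.mem_Icc] at hu ⊢; omega, ?_, ?_⟩
    · push_cast
      rwa [neg_div, abs_neg, ← abs_neg x]
    · push_cast
      rw [← abs_neg]
      convert h2 using 2
      ring
  · rw [abs_of_nonneg h] at hx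
    have h0 : 0 ≤ ⌊M * x⌋ := Int.floor_nonneg.2 (by positivity)
    have h0' : (0 : ℝ) ≤ ⌊M * x⌋ := by exact_mod_cast h0
    have h1 : (⌊M * x⌋ : ℝ) ≤ M * x := Int.floor_le _
    have h2 : M * x < ⌊M * x⌋ + 1 := Int.lt_floor_add_one _
    refine ⟨⌊M * x⌋, ?_, ?_, ?_⟩
    · simp only [Finset.mem_Icc]
      refine ⟨by omega, ?_⟩
      have : (⌊M * x⌋ : ℝ) ≤ (M : ℤ) := by
        push_cast
        nlinarith
      exact_mod_cast this
    · rw [abs_of_nonneg (by positivity), abs_of_nonneg h, div_le_iff₀ hM']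
      linarith
    · rw [abs_of_nonneg, sub_le_iff_le_add, ← add_div, le_div_iff₀ hM']
      · linarith
      · rw [sub_nonneg, div_le_iff₀ hM']
        linarith

variable {𝕜 : Type*} [RCLike 𝕜]

/-- The points of the square grid of mesh `1 / M`. -/
def gridPoint (𝕜 : Type*) [RCLike 𝕜] (M : ℕ) (u : ℤ × ℤ) : 𝕜 :=
  (((u.1 : ℝ) / M : ℝ) : 𝕜) + (((u.2 : ℝ) / M : ℝ) : 𝕜) * RCLike.I

lemma exists_gridPoint_near {M : ℕ} (hM : 0 < M) {x : 𝕜} (hx : ‖x‖ ≤ 1) :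
    ∃ u ∈ Finset.Icc (-(M : ℤ)) M ×ˢ Finset.Icc (-(M : ℤ)) M,
      ‖gridPoint 𝕜 M u‖ ≤ ‖x‖ ∧ ‖x - gridPoint 𝕜 M u‖ ≤ 2 / M := by
  obtain ⟨u, hu, h1, h2⟩ := exists_int_div_near hM ((RCLike.abs_re_le_norm x).trans hx)
  obtain ⟨v, hv, h3, h4⟩ := exists_int_div_near hM ((RCLike.abs_im_le_norm x).trans hx)
  have hI : |RCLike.im (RCLike.I : 𝕜)| ≤ 1 :=
    (RCLike.abs_im_le_norm _).trans norm_I_le_one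
  refine ⟨(u, v), by simp only [mem_product]; exact ⟨hu, hv⟩, ?_, ?_⟩
  · rw [← sq_le_sq₀ (norm_nonneg _) (norm_nonneg _), RCLike.norm_sq_eq_def, RCLike.norm_sq_eq_def]
    simp only [gridPoint, map_add, RCLike.ofReal_re, RCLike.re_ofReal_mul, RCLike.I_re, mul_zero,
      add_zero, RCLike.ofReal_im, RCLike.im_ofReal_mul, zero_add]
    refine add_le_add ?_ ?_
    · exact abs_le_iff_mul_self_le.1 h1
    · refine abs_le_iff_mul_self_le.1 ?_
      rw [abs_mul]
      exact (mul_le_of_le_one_right (abs_nonneg _) hI).trans h3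
  · have e : x - gridPoint 𝕜 M (u, v) = ((RCLike.re x - (u : ℝ) / M : ℝ) : 𝕜) +
        ((RCLike.im x - (v : ℝ) / M : ℝ) : 𝕜) * RCLike.I := by
      conv_lhs => rw [← RCLike.re_add_im x]
      simp only [gridPoint]
      push_cast
      ring
    rw [e]
    refine (norm_add_le _ _).trans ?_
    rw [norm_mul, RCLike.norm_ofReal, RCLike.norm_ofReal]
    have : |RCLike.im x - (v : ℝ) / M| * ‖(RCLike.I : 𝕜)‖ ≤ 1 / M :=
      (mul_le_of_le_one_right (abs_nonneg _) norm_I_le_one).trans h4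
    calc _ ≤ 1 / (M : ℝ) + 1 / M := add_le_add h2 this
      _ = 2 / M := by ring

lemma norm_prod_sub_prod_le {ι : Type*} (S : Finset ι) {x y : ι → 𝕜} (hx : ∀ i, ‖x i‖ ≤ 1)
    (hy : ∀ i, ‖y i‖ ≤ 1) : ‖∏ i ∈ S, x i - ∏ i ∈ S, y i‖ ≤ ∑ i ∈ S, ‖x i - y i‖ := by
  classical
  induction S using Finset.induction_on with
  | empty => simp
  | insert i S hi ih =>
    rw [prod_insert hi, prod_insert hi, sum_insert hi]
    have h1 : ‖∏ i ∈ S, x i‖ ≤ 1 := by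
      rw [norm_prod]; exact prod_le_one (fun _ _ => norm_nonneg _) fun i _ => hx i
    calc _ = ‖(x i - y i) * ∏ i ∈ S, x i + y i * (∏ i ∈ S, x i - ∏ i ∈ S, y i)‖ := by
          congr 1; ring
      _ ≤ ‖x i - y i‖ * ‖∏ i ∈ S, x i‖ + ‖y i‖ * ‖∏ i ∈ S, x i - ∏ i ∈ S, y i‖ := by
          rw [← norm_mul, ← norm_mul]; exact norm_add_le _ _
      _ ≤ ‖x i - y i‖ * 1 + 1 * ∑ i ∈ S, ‖x i - y i‖ := by
          gcongr
          exact hy i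
      _ = _ := by ring

variable {m n : ℕ}

lemma sum_norm_sq_prod_le {z : Fin m → Fin n → 𝕜} (hz : ∀ k, lpNorm 2 (z k) ≤ 1) :
    ∑ J : Fin m → Fin n, ‖∏ k, z k (J k)‖ ^ 2 ≤ 1 := by
  simp only [norm_prod, ← prod_pow]
  rw [← Fintype.prod_sum fun k j => ‖z k j‖ ^ 2]
  refine prod_le_one (fun _ _ => by positivity) fun k _ => ?_
  have := hz k
  rwa [lpNorm_two, Real.sqrt_le_one] at this

/-- Multilinear forms with random signs (Kahane-Salem-Zygmund), on Euclidean balls. -/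
theorem exists_sgn_isFormBound_two (𝕜 : Type*) [RCLike 𝕜] (m : ℕ) :
    ∃ K : ℝ, ∀ n : ℕ, 0 < n → ∀ w : (Fin m → Fin n) → ℝ, (∀ J, |w J| ≤ 1) →
      ∃ ε : (Fin m → Fin n) → Bool, IsFormBound (fun _ => 2)
        (fun J => sgn 𝕜 (ε J) * (w J : 𝕜)) (K * (√n * (1 + Real.log n))) := by
  classical
  refine ⟨2 * (2 * m * (m + 2) + 3) + 2 * m, fun n hn w hw => ?_⟩
  have hn' : (0 : ℝ) < n := Nat.cast_pos.2 hn
  have hn1 : (1 : ℝ) ≤ n := Nat.one_le_cast.2 hn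
  have hlog := Real.log_natCast_nonneg n
  -- There are n^m coefficients of modulus at most 1, and a mesh 1/n^m keeps the total
  -- discretisation error below 2m.
  set M : ℕ := n ^ m with hMdef
  have hM : 0 < M := by positivity
  have hM' : (0 : ℝ) < M := Nat.cast_pos.2 hM
  let Γ := Finset.Icc (-(M : ℤ)) M ×ˢ Finset.Icc (-(M : ℤ)) M
  let y : (Fin m → Fin n → Γ) → Fin m → Fin n → 𝕜 := fun u k j => gridPoint 𝕜 M (u k j)
  -- Grid points outside the Euclidean balls get zero coefficients, so the variance bound holds for
  -- every index.
  let c : (Fin m → Fin n → Γ) → (Fin m → Fin n) → 𝕜 := fun u J =>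
    if ∀ k, lpNorm 2 (y u k) ≤ 1 then (w J : 𝕜) * ∏ k, y u k (J k) else 0
  have hcard : (Fintype.card (Fin m → Fin n → Γ) : ℝ) ≤
      Real.exp (2 * m * n * (2 + m * Real.log n)) := by
    have h1 : (2 * M + 1 : ℝ) ≤ Real.exp (2 + m * Real.log n) := by
      have h3 : (3 : ℝ) ≤ Real.exp 2 := by
        have := Real.add_one_le_exp (2 : ℝ)
        linarith
      rw [Real.exp_add, ← Real.log_pow, Real.exp_log (by positivity)]
      have hM1 : (1 : ℝ) ≤ M := Nat.one_le_cast.2 hM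
      have : (n : ℝ) ^ m = M := by simp [hMdef]
      rw [this]
      nlinarith
    have h2 : (Fintype.card (Fin m → Fin n → Γ) : ℝ) = (2 * M + 1) ^ (2 * (n * m)) := by
      have hI : (Finset.Icc (-(M : ℤ)) M).card = 2 * M + 1 := by
        rw [Int.card_Icc]; omega
      simp only [Fintype.card_pi, prod_const, card_univ, Fintype.card_fin, Fintype.card_coe, Γ,
        card_product, hI]
      push_cast
      rw [← pow_two, ← pow_mul, ← pow_mul]
    rw [h2]
    calc _ ≤ Real.exp (2 + m * Real.log n) ^ (2 * (n * m)) := by gcongr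
      _ = _ := by
        rw [← Real.exp_nat_mul]
        congr 1
        push_cast
        ring
  -- The logarithm of the grid size is of order n (1 + log n), so r = √n balances both terms up to a
  -- logarithm.
  obtain ⟨ε, hε⟩ := exists_norm_sum_sgn_le (r := √n) (by positivity) hcard c fun u => by
    by_cases hu : ∀ k, lpNorm 2 (y u k) ≤ 1
    · refine (sum_norm_sq_prod_le hu).trans' (sum_le_sum fun J _ => ?_)
      simp only [c, if_pos hu]
      rw [norm_mul, RCLike.norm_ofReal]
      gcongr
      exact mul_le_of_le_one_left (norm_nonneg _) (hw J)
    · simp [c, if_neg hu]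
  refine ⟨ε, fun z hz => ?_⟩
  have hz1 : ∀ k j, ‖z k j‖ ≤ 1 := fun k j => (norm_apply_le_lpNorm (by simp) _ j).trans (hz k)
  choose v hv hv1 hv2 using fun k j => exists_gridPoint_near hM (hz1 k j)
  let u : Fin m → Fin n → Γ := fun k j => ⟨v k j, hv k j⟩
  have hu : ∀ k, lpNorm 2 (y u k) ≤ 1 := fun k =>
    (lpNorm_mono (by simp) (hv1 k)).trans (hz k)
  have hgrid := hε u
  simp only [c, if_pos hu, ← mul_assoc] at hgrid
  set a : (Fin m → Fin n) → 𝕜 := fun J => sgn 𝕜 (ε J) * (w J : 𝕜)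
  have hdiff : ‖arrayForm a z - arrayForm a (y u)‖ ≤ 2 * m := by
    rw [arrayForm, arrayForm, ← sum_sub_distrib]
    calc _ ≤ ∑ J : Fin m → Fin n, (m * (2 / M) : ℝ) := by
          refine (norm_sum_le _ _).trans (sum_le_sum fun J _ => ?_)
          rw [← mul_sub, norm_mul]
          have ha : ‖a J‖ ≤ 1 := by simpa [a] using hw J
          refine (mul_le_of_le_one_left (norm_nonneg _) ha).trans ?_
          refine (norm_prod_sub_prod_le _ (fun k => hz1 k (J k))
            (fun k => (hv1 k (J k)).trans (hz1 k (J k)))).trans ?_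
          refine (sum_le_sum fun k _ => hv2 k (J k)).trans ?_
          simp
      _ = 2 * m := by
          simp only [sum_const, card_univ, Fintype.card_pi, prod_const, Fintype.card_fin,
            nsmul_eq_mul, ← hMdef]
          field_simp
  have hs1 : 1 ≤ √(n : ℝ) := Real.one_le_sqrt.2 hn1
  have hss : √(n : ℝ) * √n = n := Real.mul_self_sqrt hn'.le
  have hB : 1 ≤ √(n : ℝ) * (1 + Real.log n) := by nlinarith
  have hL : (2 * m * n * (2 + m * Real.log n) + 2) / √n + √n / 2 ≤
      (2 * m * (m + 2) + 3) * (√n * (1 + Real.log n)) := by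
    rw [← le_sub_iff_add_le, div_le_iff₀ (by positivity)]
    set s := √(n : ℝ)
    set l := Real.log n
    have e1 : ((2 * m * (m + 2) + 3) * (s * (1 + l)) - s / 2) * s =
        n * ((2 * m * (m + 2) + 3) * (1 + l) - 1 / 2) := by rw [← hss]; ring
    rw [e1]
    have hm0 : (0 : ℝ) ≤ m := Nat.cast_nonneg m
    have e2 : (2 * m * (2 + m * l) + 2 : ℝ) ≤ (2 * m * (m + 2) + 3) * (1 + l) - 1 / 2 := by
      have : 0 ≤ (m : ℝ) * l := by positivity
      have : 0 ≤ (m : ℝ) * m := by positivity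
      nlinarith
    calc _ ≤ n * (2 * m * (2 + m * l) + 2) := by nlinarith
      _ ≤ _ := by gcongr
  calc ‖arrayForm a z‖ ≤ ‖arrayForm a (y u)‖ + ‖arrayForm a z - arrayForm a (y u)‖ := by
        have := norm_add_le (arrayForm a (y u)) (arrayForm a z - arrayForm a (y u))
        simpa using this
    _ ≤ 2 * ((2 * m * (m + 2) + 3) * (√n * (1 + Real.log n))) +
          2 * m * (√n * (1 + Real.log n)) := by
        refine add_le_add (hgrid.trans (by linarith)) (hdiff.trans ?_)
        exact le_mul_of_one_le_right (by positivity) hB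
    _ = _ := by ring

end RandomSigns

/-! ### Sharpness of the exponents after position k₀. -/

section Sharpness

variable {𝕜 : Type*} [RCLike 𝕜] {m n : ℕ}

lemma lpNorm_two_le_rpow_mul {p : ℝ≥0∞} (hp : 2 ≤ p) (hn : 0 < n) (x : Fin n → 𝕜) :
    lpNorm 2 x ≤ (n : ℝ) ^ (2⁻¹ - p⁻¹).toReal * lpNorm p x := by
  have hp0 : p ≠ 0 := (zero_lt_two.trans_le hp).ne'
  have := lpNorm_mul_le (p := (2⁻¹ - p⁻¹)⁻¹) (q := p) (r := 2) (by simp) hp0 (by simp)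
    (by rw [inv_inv, tsub_add_cancel_of_le (ENNReal.inv_le_inv.2 hp)]) (fun _ => (1 : 𝕜)) x
  rw [lpNorm_of_norm_eq_one (p := (2⁻¹ - p⁻¹)⁻¹) (by simp) hn (by simp), inv_inv] at this
  simpa using this

/-- Forms with random signs that depend on the first variables only through one coordinate. -/
lemma exists_isFormBound_of_two_le (𝕜 : Type*) [RCLike 𝕜] {p : Fin m → ℝ≥0∞} (hp : ∀ k, p k ≠ 0)
    {k₀ : Fin m} (hp2 : ∀ k, k₀ ≤ k → 2 ≤ p k) :
    ∃ K : ℝ, ∀ n : ℕ, 0 < n → ∃ i : Fin n, ∃ a : (Fin m → Fin n) → 𝕜,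
      (∀ J, ‖a J‖ = ∏ l, (if k₀ ≤ l then 1 else (Pi.single i 1 : Fin n → ℝ)) (J l)) ∧
      IsFormBound p a (K * ((n : ℝ) ^ (1 / 2 + ∑ l ∈ Ici k₀, (2⁻¹ - (p l)⁻¹).toReal) *
        (1 + Real.log n))) := by
  obtain ⟨K, hK⟩ := exists_sgn_isFormBound_two 𝕜 m
  refine ⟨K, fun n hn => ⟨⟨0, hn⟩, ?_⟩⟩
  set i : Fin n := ⟨0, hn⟩
  have hn' : (0 : ℝ) < n := Nat.cast_pos.2 hn
  set f : Fin m → Fin n → ℝ := fun l => if k₀ ≤ l then 1 else Pi.single i 1 with hf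
  have hf0 : ∀ l j, 0 ≤ f l j := fun l j => by
    by_cases hl : k₀ ≤ l
    · simp [hf, hl]
    · by_cases h : j = i <;> simp [hf, hl, h]
  have hf1 : ∀ l j, f l j ≤ 1 := fun l j => by
    by_cases hl : k₀ ≤ l
    · simp [hf, hl]
    · by_cases h : j = i <;> simp [hf, hl, h]
  have hw0 : ∀ J : Fin m → Fin n, 0 ≤ ∏ l, f l (J l) := fun J => prod_nonneg fun _ _ => hf0 _ _
  obtain ⟨ε, hε⟩ := hK n hn (fun J => ∏ l, f l (J l)) fun J => by
    rw [abs_of_nonneg (hw0 J)]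
    exact prod_le_one (fun _ _ => hf0 _ _) fun _ _ => hf1 _ _
  refine ⟨fun J => sgn 𝕜 (ε J) * ((∏ l, f l (J l) : ℝ) : 𝕜), fun J => ?_, fun z hz => ?_⟩
  · rw [norm_mul, norm_sgn, one_mul, RCLike.norm_ofReal, abs_of_nonneg (hw0 J)]
  -- These constants bound the passage from ℓ_{p_l} to ℓ₂; a slot before k₀ is masked to one
  -- coordinate and costs nothing.
  let c : Fin m → ℝ := fun l => if k₀ ≤ l then (n : ℝ) ^ (2⁻¹ - (p l)⁻¹).toReal else 1
  have hc : ∀ l, 0 < c l := fun l => by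
    simp only [c]; split_ifs <;> positivity
  let y : Fin m → Fin n → 𝕜 := fun l j => ((c l)⁻¹ : ℝ) * ((f l j : 𝕜) * z l j)
  have hy : ∀ l, lpNorm 2 (y l) ≤ 1 := fun l => by
    have e : lpNorm 2 (y l) = (c l)⁻¹ * lpNorm 2 (fun j => (f l j : 𝕜) * z l j) :=
      lpNorm_mul_left (by simp) (by have := hc l; positivity) fun j => by
        simp only [y, norm_mul, RCLike.norm_ofReal]
        rw [abs_of_pos (inv_pos.2 (hc l))]
    rw [e, inv_mul_le_iff₀ (hc l), mul_one]
    by_cases hl : k₀ ≤ l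
    · simp only [hf, c, if_pos hl, Pi.one_apply, RCLike.ofReal_one, one_mul]
      exact (lpNorm_two_le_rpow_mul (hp2 l hl) hn _).trans
        (mul_le_of_le_one_right (by positivity) (hz l))
    · simp only [hf, c, if_neg hl]
      have : (fun j => (((Pi.single i 1 : Fin n → ℝ) j : ℝ) : 𝕜) * z l j) =
          Pi.single i (z l i) := by
        ext j
        by_cases h : j = i
        · subst h; simp
        · simp [h]
      rw [this, lpNorm_single (by simp)]
      exact (norm_apply_le_lpNorm (hp l) _ _).trans (hz l)
  -- Since the mask is idempotent, one copy stays in the coefficients while another is moved onto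
  -- the variables.
  have hff : ∀ l j, f l j * f l j = f l j := fun l j => by
    by_cases hl : k₀ ≤ l
    · simp [hf, hl]
    · by_cases h : j = i <;> simp [hf, hl, h]
  have hcy : ∀ l j, (f l j : 𝕜) * z l j = (c l : 𝕜) * ((f l j : 𝕜) * y l j) := fun l j => by
    have : (c l : 𝕜) ≠ 0 := by simpa using (hc l).ne'
    have h2 : (f l j : 𝕜) * (f l j : 𝕜) = f l j := by rw [← RCLike.ofReal_mul, hff]
    simp only [y, RCLike.ofReal_inv]
    field_simp
    rw [pow_two, h2]
  have key : arrayForm (fun J => sgn 𝕜 (ε J) * ((∏ l, f l (J l) : ℝ) : 𝕜)) z =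
      ((∏ l, c l : ℝ) : 𝕜) * arrayForm (fun J => sgn 𝕜 (ε J) * ((∏ l, f l (J l) : ℝ) : 𝕜)) y := by
    rw [arrayForm, arrayForm, mul_sum]
    refine sum_congr rfl fun J _ => ?_
    push_cast
    rw [mul_assoc, ← prod_mul_distrib]
    simp only [hcy]
    rw [prod_mul_distrib, prod_mul_distrib]
    ring
  have hcprod : ∏ l, c l = (n : ℝ) ^ ∑ l ∈ Ici k₀, (2⁻¹ - (p l)⁻¹).toReal := by
    rw [Real.rpow_sum_of_pos hn', show Ici k₀ = univ.filter (k₀ ≤ ·) by ext; simp, prod_filter]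
  rw [key, norm_mul, RCLike.norm_ofReal, abs_of_pos (prod_pos fun l _ => hc l), hcprod]
  calc _ ≤ (n : ℝ) ^ (∑ l ∈ Ici k₀, (2⁻¹ - (p l)⁻¹).toReal) * (K * (√n * (1 + Real.log n))) := by
        gcongr
        exact hε y hy
    _ = _ := by
        rw [Real.rpow_add hn', Real.sqrt_eq_rpow]
        ring

/-- The coefficients of the random form have product moduli, so its mixed norm is exactly n^{∑
1/t_l}, to be compared with the growth of the form norm. -/
lemma Admissible.sum_le {p t : Fin m → ℝ≥0∞} (hp : ∀ k, p k ≠ 0) (h : Admissible 𝕜 p t)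
    {k₀ : Fin m} (hp2 : ∀ k, k₀ ≤ k → 2 ≤ p k) :
    ∑ l ∈ Ici k₀, ((t l)⁻¹).toReal ≤ 1 / 2 + ∑ l ∈ Ici k₀, (2⁻¹ - (p l)⁻¹).toReal := by
  have ht : ∀ k, t k ≠ 0 := fun k => (h.1 k).ne'
  obtain ⟨C, hC0, hC⟩ := h.exists_mixedNorm_le hp
  obtain ⟨K, hK⟩ := exists_isFormBound_of_two_le 𝕜 hp hp2
  refine le_of_forall_rpow_le (K := C * K) fun n hn => ?_
  have hn' : (0 : ℝ) < n := Nat.cast_pos.2 hn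
  obtain ⟨i, a, ha, haM⟩ := hK n hn
  have := hC n hn a _ haM
  rw [mul_assoc]
  refine this.trans' (le_of_eq ?_)
  rw [mixedNorm_prod ht (fun l j => ?_) ha, Real.rpow_sum_of_pos hn',
    show Ici k₀ = univ.filter (k₀ ≤ ·) by ext; simp, prod_filter]
  · refine prod_congr rfl fun l _ => ?_
    split_ifs with hl
    · exact (lpNorm_of_norm_eq_one (ht l) hn (by simp)).symm
    · simp [lpNorm_single, ht]
  · by_cases hl : k₀ ≤ l
    · simp [hl]
    · by_cases h : j = i <;> simp [hl, h]

/-- With N slots from k₀ on and T = `tailSum p k₀`, both sides of `Admissible.sum_le` equal (N +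
1)/2 - T for the unchanged tuple; lowering an entry 2 makes the left side too large. -/
lemma not_admissible_update {p : Fin m → ℝ≥0∞} (hp : ∀ k, p k ≠ 0) {k₀ : Fin m}
    (hT : tailSum p k₀ ≤ 1) (hp2 : ∀ k, k₀ ≤ k → 2 ≤ p k) {k : Fin m} (hk : k₀ < k) {r : ℝ≥0∞}
    (hr0 : 0 < r) (hr : r < 2) : ¬ Admissible 𝕜 p (Function.update (exponents p k₀) k r) := by
  intro h
  have key := h.sum_le hp hp2
  have hpt : ∀ l, (p l)⁻¹ ≠ ∞ := fun l => by simpa using hp l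
  have e1 : ∀ l ∈ Ici k₀, ((Function.update (exponents p k₀) k r l)⁻¹).toReal =
      1 / 2 + ((if l = k₀ then 1 / 2 - (tailSum p k₀).toReal else 0) +
        if l = k then (r⁻¹).toReal - 1 / 2 else 0) := fun l hl => by
    rw [mem_Ici] at hl
    rcases eq_or_ne l k with rfl | hlk
    · simp [hk.ne']
    · rw [Function.update_of_ne hlk, if_neg hlk, exponents]
      rcases hl.eq_or_lt with rfl | hl
      · rw [if_pos le_rfl, if_pos rfl, inv_inv, ENNReal.toReal_sub_of_le hT (by simp)]
        simp only [ENNReal.toReal_one]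
        ring
      · simp [hl.not_ge, hl.ne']
  have e2 : ∀ l ∈ Ici k₀, (2⁻¹ - (p l)⁻¹).toReal = 1 / 2 - ((p l)⁻¹).toReal := fun l hl => by
    rw [ENNReal.toReal_sub_of_le (ENNReal.inv_le_inv.2 (hp2 l (mem_Ici.1 hl))) (by simp)]
    simp
  have e3 : (tailSum p k₀).toReal = ∑ l ∈ Ici k₀, ((p l)⁻¹).toReal := by
    rw [tailSum, ENNReal.toReal_sum (fun l _ => by simpa using hp l)]
    simp
  rw [sum_congr rfl e1, sum_congr rfl e2, sum_add_distrib, sum_add_distrib, sum_ite_eq',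
    sum_ite_eq', if_pos (by simp), if_pos (by simpa using hk.le), sum_sub_distrib, ← e3] at key
  have h1 : (r⁻¹).toReal ≤ (2⁻¹ : ℝ≥0∞).toReal := by
    simp only [ENNReal.toReal_inv, ENNReal.toReal_ofNat] at key ⊢
    linarith
  have h2 := (ENNReal.toReal_le_toReal (by simpa using hr0.ne') (by simp)).1 h1
  exact absurd (ENNReal.inv_le_inv.1 h2) (not_le.2 hr)

end Sharpness

end HardyLittlewood

end

theorem mainTheorem3 (m : ℕ) (hm : 2 ≤ m) :
    ∃ C : ℝ, ∀ (𝕜 : Type*) [RCLike 𝕜] (p : Fin m → ℝ≥0∞) (k₀ : Fin m),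
      (∀ k, 1 ≤ p k) →
      ∑ k, 1 / p k = 1 →
      1 / 2 ≤ HardyLittlewood.tailSum p ⟨1, hm⟩ →
      HardyLittlewood.tailSum p ⟨1, hm⟩ < 1 →
      IsGreatest {t : Fin m | 1 / 2 ≤ HardyLittlewood.tailSum p t} k₀ →
        HardyLittlewood.HLInequalityWith 𝕜 p (HardyLittlewood.exponents p k₀) C ∧
        (∀ k ≤ k₀,
          HardyLittlewood.IsOptimalExponent 𝕜 p k (HardyLittlewood.exponents p k₀ k)) ∧
        (2 ≤ p k₀ →
          HardyLittlewood.GloballySharp 𝕜 p (HardyLittlewood.exponents p k₀)) := by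
  refine ⟨√3 ^ m, fun 𝕜 _ p k₀ hp1 hsum _ _ hk₀ => ?_⟩
  have hp : ∀ k, p k ≠ 0 := fun k => (zero_lt_one.trans_le (hp1 k)).ne'
  simp only [one_div] at hsum hk₀
  have hT : ∀ k, HardyLittlewood.tailSum p k ≤ 1 := fun k => by
    rw [← hsum, HardyLittlewood.tailSum]
    simp only [one_div]
    exact Finset.sum_le_sum_of_subset (Finset.subset_univ _)
  have hHL : HardyLittlewood.HLInequalityWith 𝕜 p (HardyLittlewood.exponents p k₀) (√3 ^ m) :=
    HardyLittlewood.hlInequalityWith_of_isFormBound hp fun n a M h =>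
      HardyLittlewood.mixedNorm_exponents_le hp hsum.le hk₀ h
  have hadm : HardyLittlewood.Admissible 𝕜 p (HardyLittlewood.exponents p k₀) :=
    ⟨fun k => zero_lt_two.trans_le (HardyLittlewood.two_le_exponents hk₀.1 k), _, hHL⟩
  have hopt : ∀ k ≤ k₀, ∀ t, HardyLittlewood.Admissible 𝕜 p t →
      HardyLittlewood.exponents p k₀ k ≤ t k := fun k hk t ht => by
    rw [HardyLittlewood.exponents, if_pos hk]
    exact ht.inv_le hp (hT k)
  refine ⟨hHL, fun k hk => ⟨⟨_, hadm, rfl⟩, ?_⟩, fun hpk => ⟨hadm, fun k r hr0 hr h => ?_⟩⟩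
  · rintro _ ⟨t, ht, rfl⟩
    exact hopt k hk t ht
  · rcases le_or_gt k k₀ with hk | hk
    · have := hopt k hk _ h
      rw [Function.update_self] at this
      exact absurd this (not_le.2 hr)
    · refine HardyLittlewood.not_admissible_update hp (hT k₀) (fun l hl => ?_) hk hr0 ?_ h
      · rcases hl.eq_or_lt with rfl | hl
        · exact hpk
        -- By maximality of k₀ the tail sums drop below 1/2 afterwards, which forces p_l ≥ 2; only
        -- p_{k₀} ≥ 2 has to be assumed.
        · have h1 : HardyLittlewood.tailSum p l < 2⁻¹ := by
            by_contra! hcon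
            exact absurd (hk₀.2 hcon) (not_le.2 hl)
          have h2 : (p l)⁻¹ ≤ HardyLittlewood.tailSum p l := by
            rw [HardyLittlewood.tailSum]
            simp only [one_div]
            exact Finset.single_le_sum (f := fun i => (p i)⁻¹) (fun _ _ => zero_le)
              (Finset.mem_Ici.2 le_rfl)
          exact ENNReal.inv_le_inv.1 (h2.trans h1.le)
      · simpa [HardyLittlewood.exponents, hk.not_ge] using hr
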